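/- **Instance.** Let $d>2$ be an integer and let $\kappa,u,v>0$ satisfy $u^2+v^2\le 1$ and $4\kappa^2/u^2+1/v^2<d+1$ (for example $\kappa=1$, $u=v=\tfrac12$ if $d\ge 20$, or $\kappa=\tfrac14$, $u=v=\tfrac1{\sqrt2}$ for every $d>2$). For $\epsilon>0$ put $\xi=\frac1{52d}$, $\gamma=\frac{1}{52\sqrt d}$, $\Delta=3\epsilon/\kappa$, and consider the linear bandit with parameter $\theta_\star=\kappa e_1\in\mathbb R^d$ and arms $$\mathcal Z=\{\xi e_1,\ e_2,\dots,e_d,\ x_2,\dots,x_d\},\qquad x_i=(\xi-\Delta)e_1+\gamma e_i .$$ Let $M_\epsilon$ be the episodic MDP with horizon $H=2$, states $s_0,s_1,\bar s_2,\dots,\bar s_{d+1}$, initial state $s_0$, actions $\mathcal Z\cup\{\mathrm{null}\}$, feature map $\phi$ into $\mathbb R^{d+1}$ given by $$\phi(s_0,z)=[uz,v]\ (z\in\mathcal Z),\quad \phi(s_0,\mathrm{null})=v\,e_{d+1},\quad \phi(s_1,\cdot)=e_1,\quad \phi(\bar s_i,\cdot)=e_i ,$$ first-step transitions $P_1(s\mid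 s_0,a)=\langle\phi(s_0,a),\mu_1(s)\rangle$, where $\mu_1(s_0)=0$, $\mu_1(s_1)=[\theta_\star/u,\tfrac1{2v}]$ and $\mu_1(\bar s_i)=\frac1d[-\theta_\star/u,\tfrac1{2v}]$, reward $0$ at step 1, and deterministic reward $\langle\phi(s,a),e_1\rangle$ at step 2 (that is, $1$ in $s_1$ and $0$ in every $\bar s_i$). Thus action $z\in\mathcal Z$ in $s_0$ yields expected episode reward $\frac12+\langle\theta_\star,z\rangle$. **Environments.** Let $\mathcal E_\epsilon$ be the set of all MDPs with $H=2$, the above states and actions, initial state $s_0$, and reward distributions on $[0,1]$, that are $(d+1)$-dimensional linear MDPs with the feature map $\phi$: $P_1(s\mid s_0,a)=\langle\phi(s_0,a),\mu(s)\rangle$ and mean rewards $\langle\phi(s,a),\theta_h\rangle$ (for $h=1$ at $s=s_0$), with $\|\phi(s,a)\|_2\le1$, $\|\sum_s|\mu(s)|\|_2\le\sqrt{d+1}$ (absolute values taken coordinatewise), $\|\theta_h\|_2\le\sqrt{d+1}$; and in which, for each step $h$, some policy $\pi$ has $\lambda_{\min}(\mathbb E_\pi[\phi(s_h,a_h)\phi(s_h,a_h)^\top])>0$.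 **Learners.** A learner plays, in each episode $k\ge1$, a policy $\pi_k$ chosen as a (possibly randomized) function of the previous episodes; it stops after a possibly random number $K\in\{0,1,2,\dots\}\cup\{\infty\}$ of episodes, and then outputs a policy $\widehat\pi$; the decision to stop after $k$ episodes and the output depend only on the first $k$ episodes and its internal randomness. It is $(\epsilon,\delta)$-PAC if on every MDP in $\mathcal E_\epsilon$, with probability at least $1-\delta$, one has $K<\infty$ and $V_0^\star-V_0^{\widehat\pi}\le\epsilon$. It has low regret on $M_\epsilon$ with constants $\mathcal C_1,\mathcal C_2,\alpha$ if on $M_\epsilon$, $\sum_{k=1}^n\mathbb E[V_0^\star-V_0^{\pi_k}]\le \mathcal C_1n^\alpha+\mathcal C_2$ for all $n\ge1$ (the policies $\pi_k$ being defined for all $k$, regardless of stopping). **Statement.** There is a universal constant $c>0$ such that for all $d>2$, all $\kappa,u,v$ as above, all $\mathcal C_1,\mathcal C_2\in\mathbb R$ and $\alpha\in(0,1)$, there is $\epsilon_0>0$ such that for every $\epsilon\in(0,\epsilon_0)$ the MDP $M_\epsilon$ is well defined and belongs to $\mathcal E_\epsilon$, and for every $\delta\in(0,\frac5{12})$, every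 learner that is $(\epsilon,\delta)$-PAC and has low regret on $M_\epsilon$ with constants $\mathcal C_1,\mathcal C_2,\alpha$ satisfies, on $M_\epsilon$, $$\mathbb E[K]\ \ge\ c\,\frac{d\,\log(1/\delta)}{\epsilon^2}.$$ -/

import Mathlib

open MeasureTheory ProbabilityTheory
open scoped ENNReal

noncomputable section

/-! ### Episodic MDPs with horizon two -/

/-- A finite-horizon MDP with horizon `H = 2`, finite state space `S` and finite action space `A`.
Every episode starts in `init`, so at step 1 only the transition kernel `trans a = P₁(· | init, a)`
and the reward law `rew₁ a = ν₁(init, a)` matter; `rew₂ s a = ν₂(s, a)` is the reward law at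
step 2, after which the episode ends. -/
structure TwoStepMDP (S A : Type) [Fintype S] [Fintype A] where
  init : S
  trans : A → stdSimplex ℝ S
  rew₁ : A → Measure ℝ
  rew₂ : S → A → Measure ℝ
  rew₁_prob : ∀ a, IsProbabilityMeasure (rew₁ a)
  rew₂_prob : ∀ s a, IsProbabilityMeasure (rew₂ s a)
  rew₁_mem : ∀ a, ∀ᵐ r ∂(rew₁ a), r ∈ Set.Icc (0 : ℝ) 1
  rew₂_mem : ∀ s a, ∀ᵐ r ∂(rew₂ s a), r ∈ Set.Icc (0 : ℝ) 1

/-- A (stochastic, Markovian) policy: `π 0` and `π 1` map states to distributions over actions,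
for steps 1 and 2 respectively. -/
abbrev Policy (S A : Type) [Fintype A] : Type := Fin 2 → S → stdSimplex ℝ A

/-- What is observed in one episode: `(a₁, r₁, s₂, a₂, r₂)`. -/
abbrev Episode (S A : Type) : Type := A × ℝ × S × A × ℝ

namespace TwoStepMDP

variable {S A : Type} [Fintype S] [Fintype A]

/-- The value `V₀^π` of a policy: its expected total reward over one episode. -/
def value (M : TwoStepMDP S A) (π : Policy S A) : ℝ :=
  ∑ a, (π 0 M.init : A → ℝ) a *
    (∫ r, r ∂(M.rew₁ a) +
      ∑ s, (M.trans a : S → ℝ) s * ∑ a', (π 1 s : A → ℝ) a' * ∫ r, r ∂(M.rew₂ s a'))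

/-- The optimal value `V₀^⋆`, the supremum of `V₀^π` over all policies. -/
def optValue (M : TwoStepMDP S A) : ℝ := ⨆ π : Policy S A, M.value π

/-- `M` is a `D`-dimensional linear MDP with initial state `s₀` and (known) feature map `φ`:
`P₁(s | s₀, a) = ⟨φ(s₀, a), μ(s)⟩`, `E[ν_h(s, a)] = ⟨φ(s, a), θ_h⟩`, with the usual
normalization. At step 1 the relations are imposed at `s₀`, the only state visited at that step. -/
def IsLinear {D : ℕ} (s₀ : S) (φ : S → A → EuclideanSpace ℝ (Fin D)) (M : TwoStepMDP S A) : Prop :=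
  M.init = s₀ ∧ (∀ s a, ‖φ s a‖ ≤ 1) ∧
  ∃ (μ : S → EuclideanSpace ℝ (Fin D)) (θ₁ θ₂ : EuclideanSpace ℝ (Fin D)),
    (∀ a s, (M.trans a : S → ℝ) s = inner ℝ (φ s₀ a) (μ s)) ∧
    (∀ a, ∫ r, r ∂(M.rew₁ a) = inner ℝ (φ s₀ a) θ₁) ∧
    (∀ s a, ∫ r, r ∂(M.rew₂ s a) = inner ℝ (φ s a) θ₂) ∧
    ‖(WithLp.toLp 2 (fun j => ∑ s, |μ s j|) : EuclideanSpace ℝ (Fin D))‖ ≤ √D ∧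
    ‖θ₁‖ ≤ √D ∧ ‖θ₂‖ ≤ √D

/-- Full rank covariates: for each step `h`, some policy has a feature covariance
`Λ_{π,h} = E_π[φ(s_h, a_h) φ(s_h, a_h)ᵀ]` whose smallest eigenvalue is positive. -/
def FullRank {D : ℕ} (φ : S → A → EuclideanSpace ℝ (Fin D)) (M : TwoStepMDP S A) : Prop :=
  (∃ π : Policy S A, ∃ lam > (0 : ℝ), ∀ w : EuclideanSpace ℝ (Fin D),
    lam * ‖w‖ ^ 2 ≤ ∑ a, (π 0 M.init : A → ℝ) a * (inner ℝ (φ M.init a) w) ^ 2) ∧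
  (∃ π : Policy S A, ∃ lam > (0 : ℝ), ∀ w : EuclideanSpace ℝ (Fin D),
    lam * ‖w‖ ^ 2 ≤ ∑ a, (π 0 M.init : A → ℝ) a * ∑ s, (M.trans a : S → ℝ) s *
      ∑ a', (π 1 s : A → ℝ) a' * (inner ℝ (φ s a') w) ^ 2)

variable [MeasurableSpace S] [MeasurableSpace A]

/-- The law of `(a₁, r₁, s₂, a₂, r₂)` when `π` is played for one episode: `a₁ ∼ π₁(init)`,
`r₁ ∼ ν₁(init, a₁)`, `s₂ ∼ P₁(· | init, a₁)`, `a₂ ∼ π₂(s₂)`, `r₂ ∼ ν₂(s₂, a₂)`. -/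
def episodeLaw (M : TwoStepMDP S A) (π : Policy S A) : Measure (Episode S A) :=
  ∑ a, ∑ s, ∑ a',
    ENNReal.ofReal ((π 0 M.init : A → ℝ) a * (M.trans a : S → ℝ) s * (π 1 s : A → ℝ) a') •
      (Measure.dirac a).prod ((M.rew₁ a).prod
        ((Measure.dirac s).prod ((Measure.dirac a').prod (M.rew₂ s a'))))

theorem measurable_episodeLaw (M : TwoStepMDP S A) : Measurable M.episodeLaw := by
  refine Measure.measurable_of_measurable_coe _ fun B _ => ?_
  simp only [episodeLaw, Measure.finsetSum_apply, Measure.smul_apply, smul_eq_mul]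
  refine Finset.measurable_sum _ fun a _ => Finset.measurable_sum _ fun s _ =>
    Finset.measurable_sum _ fun a' _ => Measurable.mul_const (Measurable.ennreal_ofReal ?_) _
  have h0 : Measurable fun π : Policy S A => (π 0 M.init : A → ℝ) a := by
    have : Measurable fun p : stdSimplex ℝ A => (p : A → ℝ) a :=
      (measurable_pi_apply a).comp measurable_subtype_coe
    exact this.comp ((measurable_pi_apply M.init).comp (measurable_pi_apply (0 : Fin 2)))
  have h1 : Measurable fun π : Policy S A => (π 1 s : A → ℝ) a' := by
    have : Measurable fun p : stdSimplex ℝ A => (p : A → ℝ) a' :=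
      (measurable_pi_apply a').comp measurable_subtype_coe
    exact this.comp ((measurable_pi_apply s).comp (measurable_pi_apply (1 : Fin 2)))
  exact (h0.mul_const _).mul h1

instance isProbabilityMeasure_episodeLaw (M : TwoStepMDP S A) (π : Policy S A) :
    IsProbabilityMeasure (M.episodeLaw π) := by
  have := M.rew₁_prob
  have := M.rew₂_prob
  constructor
  simp only [episodeLaw, Measure.finsetSum_apply, Measure.smul_apply, smul_eq_mul, measure_univ,
    mul_one]
  have hx : ∀ {ι : Type} [Fintype ι] (p : stdSimplex ℝ ι) (i : ι), 0 ≤ (p : ι → ℝ) i :=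
    fun p i => p.2.1 i
  have hs : ∀ {ι : Type} [Fintype ι] (p : stdSimplex ℝ ι), ∑ i, (p : ι → ℝ) i = 1 :=
    fun p => p.2.2
  have key : ∀ a s a', 0 ≤ (π 0 M.init : A → ℝ) a * (M.trans a : S → ℝ) s * (π 1 s : A → ℝ) a' :=
    fun a s a' => mul_nonneg (mul_nonneg (hx _ _) (hx _ _)) (hx _ _)
  rw [← ENNReal.ofReal_one]
  simp_rw [← ENNReal.ofReal_sum_of_nonneg fun a' (_ : a' ∈ Finset.univ) => key _ _ a']
  simp_rw [← Finset.mul_sum, hs, mul_one]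
  simp_rw [← ENNReal.ofReal_sum_of_nonneg fun s (_ : s ∈ Finset.univ) =>
    mul_nonneg (hx (π 0 M.init) _) (hx (M.trans _) s)]
  simp_rw [← Finset.mul_sum, hs, mul_one]
  rw [← ENNReal.ofReal_sum_of_nonneg fun a (_ : a ∈ Finset.univ) => hx _ a, hs]

/-- The Markov kernel sending a policy to the law of an episode played with it. -/
def episodeKernel (M : TwoStepMDP S A) : Kernel (Policy S A) (Episode S A) where
  toFun := M.episodeLaw
  measurable' := M.measurable_episodeLaw

instance (M : TwoStepMDP S A) : IsMarkovKernel M.episodeKernel :=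
  ⟨fun π => inferInstanceAs (IsProbabilityMeasure (M.episodeLaw π))⟩

end TwoStepMDP

/-! ### Learners -/

/-- An online learner which eventually stops and recommends a policy. It may randomize through a
seed drawn once at the start. Given the seed and the first `k` episodes, `play k` is the policy
played in episode `k + 1` (defined for all `k`, whether or not the learner has stopped), `halt k`
is the event that it is ready to stop after `k` episodes, and `output k` is the policy it
recommends if it does so. -/
structure Learner (S A : Type) [Fintype A] [MeasurableSpace S] [MeasurableSpace A] where
  Seed : Type
  measSeed : MeasurableSpace Seed
  seedLaw : Measure Seed
  seedLaw_prob : IsProbabilityMeasure seedLaw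
  play : (k : ℕ) → Seed × (Fin k → Episode S A) → Policy S A
  measurable_play : ∀ k, Measurable (play k)
  halt : (k : ℕ) → Set (Seed × (Fin k → Episode S A))
  measurableSet_halt : ∀ k, MeasurableSet (halt k)
  output : (k : ℕ) → Seed × (Fin k → Episode S A) → Policy S A
  measurable_output : ∀ k, Measurable (output k)

namespace Learner

variable {S A : Type} [Fintype A] [MeasurableSpace S] [MeasurableSpace A]

instance (L : Learner S A) : MeasurableSpace L.Seed := L.measSeed
instance (L : Learner S A) : IsProbabilityMeasure L.seedLaw := L.seedLaw_prob

/-- Coordinate `0` of a run is the seed, coordinate `n + 1` is the `(n + 1)`-st episode. -/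
def Coord (L : Learner S A) : ℕ → Type
  | 0 => L.Seed
  | _ + 1 => Episode S A

instance (L : Learner S A) : (n : ℕ) → MeasurableSpace (L.Coord n)
  | 0 => L.measSeed
  | _ + 1 => inferInstanceAs (MeasurableSpace (Episode S A))

/-- The sample space of the interaction: the seed followed by infinitely many episodes. -/
abbrev Run (L : Learner S A) : Type := (n : ℕ) → L.Coord n

/-- The seed and the first `k` episodes, read off from the first coordinates of a run. -/
def prefixObs (L : Learner S A) (k : ℕ) (x : (i : Finset.Iic k) → L.Coord i) :
    L.Seed × (Fin k → Episode S A) :=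
  (x ⟨0, Finset.mem_Iic.2 (Nat.zero_le k)⟩, fun i => x ⟨i.1 + 1, Finset.mem_Iic.2 i.2⟩)

theorem measurable_prefixObs (L : Learner S A) (k : ℕ) : Measurable (L.prefixObs k) :=
  Measurable.prodMk (measurable_pi_apply (X := fun i : Finset.Iic k => L.Coord i) _)
    (measurable_pi_lambda _ fun i : Fin k =>
      measurable_pi_apply (X := fun i : Finset.Iic k => L.Coord i)
        ⟨i.1 + 1, Finset.mem_Iic.2 i.2⟩)

/-- The seed and the first `k` episodes of a run. -/
def obs (L : Learner S A) (k : ℕ) (ω : L.Run) : L.Seed × (Fin k → Episode S A) :=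
  (ω 0, fun i => ω (i.1 + 1))

/-- The number of episodes `K` after which the learner stops (`⊤` if it never does). -/
def stopTime (L : Learner S A) (ω : L.Run) : ℕ∞ :=
  ⨅ (k : ℕ) (_ : L.obs k ω ∈ L.halt k), (k : ℕ∞)

variable [Fintype S]

/-- The law of the next episode given the seed and the first `k` episodes. -/
def stepKernel (L : Learner S A) (M : TwoStepMDP S A) (k : ℕ) :
    Kernel ((i : Finset.Iic k) → L.Coord i) (L.Coord (k + 1)) :=
  M.episodeKernel.comap (fun x => L.play k (L.prefixObs k x))
    ((L.measurable_play k).comp (L.measurable_prefixObs k))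

instance (L : Learner S A) (M : TwoStepMDP S A) (k : ℕ) : IsMarkovKernel (L.stepKernel M k) :=
  inferInstanceAs (IsMarkovKernel (M.episodeKernel.comap _ _))

/-- The law of the interaction of the learner with the environment `M`: the seed has law
`seedLaw`, and given the past, episode `k + 1` is played in `M` with the policy `play k`. -/
def runLaw (L : Learner S A) (M : TwoStepMDP S A) : Measure L.Run :=
  Kernel.trajMeasure (X := L.Coord) L.seedLaw (L.stepKernel M)

/-- Low regret on `M`:
`E[∑_{k=1}^n (V₀^⋆ - V₀^{π_k})] ≤ C₁ n^α + C₂` for all numbers of episodes `n ≥ 1`. -/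
def LowRegret (L : Learner S A) (M : TwoStepMDP S A) (C₁ C₂ α : ℝ) : Prop :=
  ∀ n : ℕ, 1 ≤ n →
    ∑ k ∈ Finset.range n, ∫ ω, (M.optValue - M.value (L.play k (L.obs k ω))) ∂(L.runLaw M)
      ≤ C₁ * (n : ℝ) ^ α + C₂

/-- The learner is `(ε, δ)`-PAC on a class of environments: on each of them, with probability at
least `1 - δ`, it stops and recommends an `ε`-optimal policy. -/
def IsPAC (L : Learner S A) (𝓜 : Set (TwoStepMDP S A)) (ε δ : ℝ) : Prop :=
  ∀ M ∈ 𝓜, ENNReal.ofReal (1 - δ) ≤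
    L.runLaw M {ω | ∃ k : ℕ, L.stopTime ω = k ∧
      M.optValue - M.value (L.output k (L.obs k ω)) ≤ ε}

/-- The expected number of episodes `E[K]` on `M`. -/
def expectedEpisodes (L : Learner S A) (M : TwoStepMDP S A) : ℝ≥0∞ :=
  ∫⁻ ω, (L.stopTime ω : ℝ≥0∞) ∂(L.runLaw M)

end Learner

/-! ### The instance -/

namespace BanditMDP

/-- The states: `start` is `s₀`, `good` is `s₁` and `bad i`, `i = 0, …, d - 1`, are
`s̄₂, …, s̄_{d+1}`. -/
inductive State (d : ℕ) : Type
  | start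
  | good
  | bad (i : Fin d)
  deriving Fintype, DecidableEq

/-- The actions: `best` is `ξ e₁`, `null` is the extra uninformative action `e_{d+1} / 2`, and
for the coordinates `i = 2, …, d` (all but the first), `basis i` is `e_i` and `near i` is
`x_i = (ξ - Δ) e₁ + γ e_i`. -/
inductive Arm (d : ℕ) : Type
  | best
  | null
  | basis (i : {j : Fin d // (j : ℕ) ≠ 0})
  | near (i : {j : Fin d // (j : ℕ) ≠ 0})
  deriving Fintype, DecidableEq

instance (d : ℕ) : MeasurableSpace (State d) := ⊤
instance (d : ℕ) : MeasurableSpace (Arm d) := ⊤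

def ξ (d : ℕ) : ℝ := 1 / (52 * d)

def γ (d : ℕ) : ℝ := 1 / (52 * √d)

/-- The arm of the linear bandit played by each action (the action `null` plays none). -/
def vec (d : ℕ) (Δ : ℝ) : Arm d → Fin d → ℝ
  | .best, j => if (j : ℕ) = 0 then ξ d else 0
  | .null, _ => 0
  | .basis i, j => if j = i.1 then 1 else 0
  | .near i, j => if (j : ℕ) = 0 then ξ d - Δ else if j = i.1 then γ d else 0

/-- The feature map into `ℝ^{d+1}`: `φ(s₀, z) = [u z, v]`, `φ(s₀, null) = v e_{d+1}`,
`φ(s₁, ·) = e₁` and `φ(s̄_i, ·) = e_i`. -/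
def feat (d : ℕ) (u v Δ : ℝ) : State d → Arm d → EuclideanSpace ℝ (Fin (d + 1))
  | .start, z => WithLp.toLp 2 (Fin.snoc (α := fun _ => ℝ) (fun j => u * vec d Δ z j) v)
  | .good, _ => EuclideanSpace.single 0 1
  | .bad i, _ => EuclideanSpace.single i.succ 1

/-- The transition vectors for the bandit parameter `θ⋆ = κ e₁`: `μ₁(s₁) = [θ⋆ / u, 1 / (2v)]`,
`μ₁(s̄_i) = (1/d) [-θ⋆ / u, 1 / (2v)]`. -/
def transVec (d : ℕ) (κ u v : ℝ) : State d → EuclideanSpace ℝ (Fin (d + 1))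
  | .start => 0
  | .good => WithLp.toLp 2
      (Fin.snoc (α := fun _ => ℝ) (fun j => if (j : ℕ) = 0 then κ / u else 0) (1 / (2 * v)))
  | .bad _ => (1 / (d : ℝ)) • WithLp.toLp 2
      (Fin.snoc (α := fun _ => ℝ) (fun j => if (j : ℕ) = 0 then -(κ / u) else 0) (1 / (2 * v)))

/-- `M` is the linear MDP built from the linear bandit: `P₁(s | s₀, a) = ⟨φ(s₀, a), μ₁(s)⟩`,
no reward at step 1 (`θ₁ = 0`), and deterministic reward `⟨φ(s, a), e₁⟩` at step 2 (`θ₂ = e₁`),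
that is, `1` in `s₁` and `0` in `s̄_i`. -/
def IsInstance (d : ℕ) (κ u v Δ : ℝ) (M : TwoStepMDP (State d) (Arm d)) : Prop :=
  M.init = .start ∧
  (∀ a s, (M.trans a : State d → ℝ) s = inner ℝ (feat d u v Δ .start a) (transVec d κ u v s)) ∧
  (∀ a, M.rew₁ a = Measure.dirac 0) ∧
  (∀ s a, M.rew₂ s a = Measure.dirac (inner ℝ (feat d u v Δ s a) (EuclideanSpace.single 0 1)))

/-- The environments on which the learner has to succeed: all `(d + 1)`-dimensional linear MDPs
with full rank covariates over the given states, actions and (known) feature map. -/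
def environments (d : ℕ) (u v Δ : ℝ) : Set (TwoStepMDP (State d) (Arm d)) :=
  {M | M.IsLinear .start (feat d u v Δ) ∧ M.FullRank (feat d u v Δ)}

end BanditMDP

end

noncomputable section

theorem map_eval_zero_trajMeasure {X : ℕ → Type*} [∀ n, MeasurableSpace (X n)]
    {κ : (n : ℕ) → Kernel ((i : Finset.Iic n) → X i) (X (n + 1))} [∀ n, IsMarkovKernel (κ n)]
    {μ₀ : Measure (X 0)} [IsProbabilityMeasure μ₀] :
    (Kernel.trajMeasure μ₀ κ).map (fun x => x 0) = μ₀ := by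
  have hr : Measurable (Preorder.frestrictLe (π := X) 0) := by fun_prop
  let z : ((i : Finset.Iic 0) → X i) → X 0 := fun x => x ⟨0, Finset.mem_Iic.2 le_rfl⟩
  have hz : Measurable z := measurable_pi_apply (X := fun i : Finset.Iic 0 => X i) _
  have hmap : (Kernel.trajMeasure μ₀ κ).map (fun x => x 0) =
      ((Kernel.trajMeasure μ₀ κ).map (Preorder.frestrictLe (π := X) 0)).map z :=
    (Measure.map_map hz hr).symm
  rw [hmap, Kernel.trajMeasure, Measure.map_comp _ _ hr, Kernel.traj_map_frestrictLe,
    Kernel.partialTraj_self, Measure.id_comp]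
  have he : Measurable (MeasurableEquiv.piUnique (fun i : Finset.Iic 0 => X i)).symm :=
    MeasurableEquiv.measurable _
  refine (Measure.map_map hz he).trans ?_
  exact Measure.map_id

theorem map_compProd_comap {α β γ : Type*} [MeasurableSpace α] [MeasurableSpace β]
    [MeasurableSpace γ] (μ : Measure α) [IsFiniteMeasure μ] {f : α → β} (hf : Measurable f)
    (κ : Kernel β γ) [IsMarkovKernel κ] :
    (μ ⊗ₘ κ.comap f hf).map (Prod.map f id) = μ.map f ⊗ₘ κ := by
  ext B hB
  have hm : Measurable (Prod.map f (id : γ → γ)) := hf.prodMap measurable_id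
  rw [Measure.map_apply hm hB, Measure.compProd_apply (hm hB),
    Measure.compProd_apply hB, lintegral_map (Kernel.measurable_kernel_prodMk_left hB) hf]
  rfl

namespace TwoStepMDP

variable {S A : Type} [Fintype S] [Fintype A] [MeasurableSpace S] [MeasurableSpace A]

theorem lintegral_episodeLaw (M : TwoStepMDP S A) (π : Policy S A)
    {f : Episode S A → ℝ≥0∞} (hf : Measurable f) :
    ∫⁻ e, f e ∂(M.episodeLaw π) = ∑ a, ∑ s, ∑ a',
      ENNReal.ofReal ((π 0 M.init : A → ℝ) a * (M.trans a : S → ℝ) s * (π 1 s : A → ℝ) a') *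
        ∫⁻ r₁, ∫⁻ r₂, f (a, r₁, s, a', r₂) ∂(M.rew₂ s a') ∂(M.rew₁ a) := by
  have := M.rew₁_prob
  have := M.rew₂_prob
  simp only [episodeLaw, lintegral_finsetSum_measure, lintegral_smul_measure, smul_eq_mul]
  refine Finset.sum_congr rfl fun a _ => Finset.sum_congr rfl fun s _ =>
    Finset.sum_congr rfl fun a' _ => ?_
  congr 1
  rw [lintegral_prod _ hf.aemeasurable, lintegral_dirac' _ (by fun_prop),
    lintegral_prod _ (by fun_prop)]
  refine lintegral_congr fun r₁ => ?_
  rw [lintegral_prod _ (by fun_prop), lintegral_dirac' _ (by fun_prop),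
    lintegral_prod _ (by fun_prop), lintegral_dirac' _ (by fun_prop)]

variable [DiscreteMeasurableSpace S] [DiscreteMeasurableSpace A]

theorem measurable_episode (w : A → S → ℝ) :
    Measurable fun e : Episode S A => w e.1 e.2.2.1 := by
  have : Measurable fun p : A × S => w p.1 p.2 := Measurable.of_discrete
  exact this.comp (measurable_fst.prodMk (measurable_fst.comp (measurable_snd.comp measurable_snd)))

/-- Changing the transition probabilities multiplies the law of an episode by the ratio `w`. -/
theorem lintegral_episodeLaw_eq_mul {M M' : TwoStepMDP S A} {w : A → S → ℝ}
    (hinit : M'.init = M.init) (h₁ : M'.rew₁ = M.rew₁) (h₂ : M'.rew₂ = M.rew₂)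
    (hw : ∀ a s, 0 ≤ w a s)
    (htrans : ∀ a s, (M'.trans a : S → ℝ) s = (M.trans a : S → ℝ) s * w a s)
    (π : Policy S A) {f : Episode S A → ℝ≥0∞} (hf : Measurable f) :
    ∫⁻ e, f e ∂(M'.episodeLaw π) =
      ∫⁻ e, f e * ENNReal.ofReal (w e.1 e.2.2.1) ∂(M.episodeLaw π) := by
  have hm := measurable_episode (S := S) (A := A) w
  rw [lintegral_episodeLaw _ _ hf, lintegral_episodeLaw _ _ (by fun_prop)]
  refine Finset.sum_congr rfl fun a _ => Finset.sum_congr rfl fun s _ =>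
    Finset.sum_congr rfl fun a' _ => ?_
  simp only [hinit, h₁, h₂, htrans]
  have e1 : (π 0 M.init : A → ℝ) a * ((M.trans a : S → ℝ) s * w a s) * (π 1 s : A → ℝ) a'
      = (π 0 M.init : A → ℝ) a * (M.trans a : S → ℝ) s * (π 1 s : A → ℝ) a' * w a s := by ring
  rw [e1, ENNReal.ofReal_mul' (hw a s), mul_assoc]
  congr 1
  simp_rw [lintegral_mul_const' _ _ ENNReal.ofReal_ne_top]
  rw [mul_comm]

omit [MeasurableSpace S] [MeasurableSpace A] [DiscreteMeasurableSpace S]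
  [DiscreteMeasurableSpace A] in
theorem exists_bound_episode (g : A → S → ℝ) :
    ∃ C, ∀ e : Episode S A, ‖g e.1 e.2.2.1‖ ≤ C := by
  refine ⟨∑ a, ∑ s, ‖g a s‖, fun e => ?_⟩
  refine le_trans ?_ (Finset.single_le_sum (f := fun a => ∑ s, ‖g a s‖)
    (fun a _ => Finset.sum_nonneg fun s _ => norm_nonneg _) (Finset.mem_univ e.1))
  exact Finset.single_le_sum (f := fun s => ‖g e.1 s‖)
    (fun s _ => norm_nonneg _) (Finset.mem_univ _)

theorem integral_episodeLaw (M : TwoStepMDP S A) (π : Policy S A) (g : A → S → ℝ) :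
    ∫ e, g e.1 e.2.2.1 ∂(M.episodeLaw π) =
      ∑ a, (π 0 M.init : A → ℝ) a * ∑ s, (M.trans a : S → ℝ) s * g a s := by
  have := M.rew₁_prob
  have := M.rew₂_prob
  have hm := measurable_episode (S := S) (A := A) g
  obtain ⟨C, hC⟩ := exists_bound_episode g
  have hint : ∀ μ : Measure (Episode S A), [IsFiniteMeasure μ] →
      Integrable (fun e => g e.1 e.2.2.1) μ := fun μ _ =>
    Integrable.of_bound hm.aestronglyMeasurable C (Filter.Eventually.of_forall hC)
  have hterm : ∀ a s a', ∫ e, g e.1 e.2.2.1 ∂((Measure.dirac a).prod ((M.rew₁ a).prod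
        ((Measure.dirac s).prod ((Measure.dirac a').prod (M.rew₂ s a'))))) = g a s := by
    intro a s a'
    have i₄ : ∀ μ : Measure (S × A × ℝ), [IsFiniteMeasure μ] →
        Integrable (fun y : S × A × ℝ => g a y.1) μ := fun μ _ =>
      Integrable.of_bound ((Measurable.of_discrete (f := g a)).comp
        measurable_fst).aestronglyMeasurable C
        (Filter.Eventually.of_forall fun y => hC (a, 0, y))
    have i₂ : ∀ μ : Measure (ℝ × S × A × ℝ), [IsFiniteMeasure μ] →
        Integrable (fun y : ℝ × S × A × ℝ => g a y.2.1) μ := fun μ _ =>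
      Integrable.of_bound ((Measurable.of_discrete (f := g a)).comp
        (measurable_fst.comp measurable_snd)).aestronglyMeasurable C
        (Filter.Eventually.of_forall fun y => hC (a, y))
    rw [integral_prod _ (hint _), integral_dirac, integral_prod _ (i₂ _)]
    simp only
    rw [integral_prod _ (i₄ _), integral_dirac]
    simp
  simp only [episodeLaw]
  rw [integral_finsetSum_measure fun a _ => integrable_finsetSum_measure.2 fun s _ =>
    integrable_finsetSum_measure.2 fun a' _ => (hint _).smul_measure ENNReal.ofReal_ne_top]
  refine Finset.sum_congr rfl fun a _ => ?_
  rw [integral_finsetSum_measure fun s _ =>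
    integrable_finsetSum_measure.2 fun a' _ => (hint _).smul_measure ENNReal.ofReal_ne_top,
    Finset.mul_sum]
  refine Finset.sum_congr rfl fun s _ => ?_
  rw [integral_finsetSum_measure fun a' _ => (hint _).smul_measure ENNReal.ofReal_ne_top]
  have h0 : ∀ a', 0 ≤ (π 0 M.init : A → ℝ) a * (M.trans a : S → ℝ) s * (π 1 s : A → ℝ) a' :=
    fun a' => mul_nonneg (mul_nonneg ((π 0 M.init).2.1 _) ((M.trans a).2.1 _)) ((π 1 s).2.1 _)
  simp_rw [integral_smul_measure, hterm, ENNReal.toReal_ofReal (h0 _), smul_eq_mul]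
  have hs : ∑ a', (π 1 s : A → ℝ) a' = 1 := (π 1 s).2.2
  rw [← Finset.sum_mul, ← Finset.mul_sum, hs]
  ring

end TwoStepMDP

namespace Learner
variable {S A : Type} [Fintype A] [MeasurableSpace S] [MeasurableSpace A]

/-- The seed of a run. -/
def seed (L : Learner S A) (ω : L.Run) : L.Seed := ω 0

theorem measurable_seed (L : Learner S A) : Measurable L.seed :=
  measurable_pi_apply (X := L.Coord) 0

theorem measurable_obs (L : Learner S A) (k : ℕ) : Measurable (L.obs k) :=
  (measurable_pi_apply (X := L.Coord) 0).prodMk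
    (measurable_pi_lambda _ fun i : Fin k => measurable_pi_apply (X := L.Coord) (i.1 + 1))

/-- The `(k + 1)`-st episode of a run. -/
def episode (L : Learner S A) (k : ℕ) (ω : L.Run) : Episode S A := ω (k + 1)

theorem measurable_episode (L : Learner S A) (k : ℕ) : Measurable (L.episode k) :=
  measurable_pi_apply (X := L.Coord) (k + 1)

theorem obs_succ (L : Learner S A) (k : ℕ) (ω : L.Run) :
    L.obs (k + 1) ω =
      ((L.obs k ω).1, Fin.snoc (α := fun _ => Episode S A) (L.obs k ω).2 (L.episode k ω)) := by
  refine Prod.ext rfl ?_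
  change (fun i : Fin (k + 1) => L.episode i ω) = Fin.snoc (α := fun _ => Episode S A)
    (fun i : Fin k => L.episode i ω) (L.episode k ω)
  funext i
  induction i using Fin.lastCases with
  | last => simp
  | cast i => simp

variable [Fintype S]

instance (L : Learner S A) (M : TwoStepMDP S A) : IsProbabilityMeasure (L.runLaw M) :=
  @Kernel.instIsProbabilityMeasureForallTrajMeasure L.Coord _ (L.stepKernel M) _
    L.seedLaw L.seedLaw_prob

/-- The kernel giving the law of the next episode from the seed and the first `k` episodes. -/
def nextKernel (L : Learner S A) (M : TwoStepMDP S A) (k : ℕ) :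
    Kernel (L.Seed × (Fin k → Episode S A)) (Episode S A) :=
  M.episodeKernel.comap (L.play k) (L.measurable_play k)

instance (L : Learner S A) (M : TwoStepMDP S A) (k : ℕ) : IsMarkovKernel (L.nextKernel M k) :=
  inferInstanceAs (IsMarkovKernel (M.episodeKernel.comap _ _))

theorem map_obs_episode (L : Learner S A) (M : TwoStepMDP S A) (k : ℕ) :
    (L.runLaw M).map (fun ω => (L.obs k ω, L.episode k ω)) =
      (L.runLaw M).map (L.obs k) ⊗ₘ L.nextKernel M k := by
  have : @IsProbabilityMeasure (L.Coord 0) _ L.seedLaw := L.seedLaw_prob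
  have h := Kernel.map_frestrictLe_trajMeasure_compProd_eq_map_trajMeasure
    (X := L.Coord) (μ₀ := L.seedLaw) (κ := L.stepKernel M) (a := k)
  change (L.runLaw M).map _ ⊗ₘ _ = (L.runLaw M).map _ at h
  have hp := L.measurable_prefixObs k
  have hr : Measurable (Preorder.frestrictLe (π := L.Coord) k) := by fun_prop
  have hs : Measurable fun ω : L.Run => ω (k + 1) := L.measurable_episode k
  have hmap : (L.runLaw M).map (fun ω => (L.obs k ω, L.episode k ω)) =
      ((L.runLaw M).map fun ω : L.Run =>
        (Preorder.frestrictLe (π := L.Coord) k ω, ω (k + 1))).map (Prod.map (L.prefixObs k) id) :=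
    (Measure.map_map (hp.prodMap measurable_id) (hr.prodMk hs)).symm
  have hobs : (L.runLaw M).map (L.obs k) =
      ((L.runLaw M).map (Preorder.frestrictLe (π := L.Coord) k)).map (L.prefixObs k) :=
    (Measure.map_map hp hr).symm
  rw [hmap, ← h, hobs]
  have := Measure.isProbabilityMeasure_map (μ := L.runLaw M) hr.aemeasurable
  exact map_compProd_comap _ hp (L.nextKernel M k)

theorem map_seed (L : Learner S A) (M : TwoStepMDP S A) :
    (L.runLaw M).map L.seed = L.seedLaw :=
  @map_eval_zero_trajMeasure L.Coord _ (L.stepKernel M) _ L.seedLaw L.seedLaw_prob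

variable {L : Learner S A} {M : TwoStepMDP S A}

theorem lintegral_obs_episode (L : Learner S A) (M : TwoStepMDP S A) (k : ℕ)
    {f : (L.Seed × (Fin k → Episode S A)) × Episode S A → ℝ≥0∞} (hf : Measurable f) :
    ∫⁻ ω, f (L.obs k ω, L.episode k ω) ∂(L.runLaw M) =
      ∫⁻ ω, ∫⁻ e, f (L.obs k ω, e) ∂(M.episodeLaw (L.play k (L.obs k ω))) ∂(L.runLaw M) := by
  have ho := L.measurable_obs k
  have := Measure.isProbabilityMeasure_map (μ := L.runLaw M) ho.aemeasurable
  rw [← lintegral_map hf (ho.prodMk (L.measurable_episode k)), map_obs_episode,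
    Measure.lintegral_compProd hf, lintegral_map hf.lintegral_kernel_prod_right' ho]
  rfl

variable [DiscreteMeasurableSpace S] [DiscreteMeasurableSpace A]

theorem integral_episode (L : Learner S A) (M : TwoStepMDP S A) (k : ℕ) (g : A → S → ℝ) :
    ∫ ω, g (L.episode k ω).1 (L.episode k ω).2.2.1 ∂(L.runLaw M) =
      ∫ ω, ∑ a, (L.play k (L.obs k ω) 0 M.init : A → ℝ) a * ∑ s, (M.trans a : S → ℝ) s * g a s
        ∂(L.runLaw M) := by
  have ho := L.measurable_obs k
  have := Measure.isProbabilityMeasure_map (μ := L.runLaw M) ho.aemeasurable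
  have hm := TwoStepMDP.measurable_episode g
  obtain ⟨C, hC⟩ := TwoStepMDP.exists_bound_episode g
  have hf : Measurable fun p : (L.Seed × (Fin k → Episode S A)) × Episode S A =>
      g p.2.1 p.2.2.2.1 := hm.comp measurable_snd
  have h1 := integral_map (μ := L.runLaw M) (ho.prodMk (L.measurable_episode k)).aemeasurable
    hf.aestronglyMeasurable
  rw [map_obs_episode, Measure.integral_compProd
    (Integrable.of_bound hf.aestronglyMeasurable C (Filter.Eventually.of_forall fun p => hC p.2)),
    integral_map ho.aemeasurable
      (hf.stronglyMeasurable.integral_kernel_prod_right'.aestronglyMeasurable)] at h1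
  rw [← h1]
  refine integral_congr_ae (Filter.Eventually.of_forall fun ω => ?_)
  exact M.integral_episodeLaw _ g

/-- The likelihood ratio of the first `n` episodes. -/
theorem lintegral_obs_eq_mul {M' : TwoStepMDP S A} {w : A → S → ℝ}
    (hinit : M'.init = M.init) (h₁ : M'.rew₁ = M.rew₁) (h₂ : M'.rew₂ = M.rew₂)
    (hw : ∀ a s, 0 ≤ w a s)
    (htrans : ∀ a s, (M'.trans a : S → ℝ) s = (M.trans a : S → ℝ) s * w a s) (n : ℕ)
    {f : L.Seed × (Fin n → Episode S A) → ℝ≥0∞} (hf : Measurable f) :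
    ∫⁻ ω, f (L.obs n ω) ∂(L.runLaw M') =
      ∫⁻ ω, f (L.obs n ω) * ENNReal.ofReal (∏ k : Fin n,
        w ((L.obs n ω).2 k).1 ((L.obs n ω).2 k).2.2.1) ∂(L.runLaw M) := by
  induction n with
  | zero =>
    have hs : ∀ M : TwoStepMDP S A, ∫⁻ ω, f (L.obs 0 ω) ∂(L.runLaw M) =
        ∫⁻ x, f (x, Fin.elim0) ∂L.seedLaw := by
      intro M
      rw [← L.map_seed M, lintegral_map (f := fun x => f (x, Fin.elim0))
        (hf.comp measurable_prodMk_right) L.measurable_seed]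
      refine lintegral_congr fun ω => congrArg f (Prod.ext rfl (Subsingleton.elim _ _))
    simp [hs]
  | succ n ih =>
    have hm := TwoStepMDP.measurable_episode w
    set g : (L.Seed × (Fin n → Episode S A)) × Episode S A → ℝ≥0∞ := fun p =>
      f (p.1.1, Fin.snoc (α := fun _ => Episode S A) p.1.2 p.2) with hg
    have hsnoc : Measurable fun p : (L.Seed × (Fin n → Episode S A)) × Episode S A =>
        (p.1.1, (Fin.snoc (α := fun _ => Episode S A) p.1.2 p.2 : Fin (n + 1) → Episode S A)) := by
      refine (measurable_fst.comp measurable_fst).prodMk (measurable_pi_lambda _ fun i => ?_)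
      induction i using Fin.lastCases with
      | last => simpa using measurable_snd
      | cast i =>
        simp only [Fin.snoc_castSucc]
        exact (measurable_pi_apply i).comp (measurable_snd.comp measurable_fst)
    have hgm : Measurable g := hf.comp hsnoc
    have hW : Measurable fun x : L.Seed × (Fin n → Episode S A) =>
        ENNReal.ofReal (∏ k : Fin n, w (x.2 k).1 (x.2 k).2.2.1) := by
      refine Measurable.ennreal_ofReal (Finset.measurable_prod _ fun k _ => ?_)
      exact hm.comp ((measurable_pi_apply k).comp measurable_snd)
    have hwm : Measurable fun p : (L.Seed × (Fin n → Episode S A)) × Episode S A =>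
        ENNReal.ofReal (w p.2.1 p.2.2.2.1) := (hm.comp measurable_snd).ennreal_ofReal
    calc ∫⁻ ω, f (L.obs (n + 1) ω) ∂(L.runLaw M')
        = ∫⁻ ω, g (L.obs n ω, L.episode n ω) ∂(L.runLaw M') := by simp only [obs_succ, hg]
      _ = ∫⁻ ω, ∫⁻ e, g (L.obs n ω, e) * ENNReal.ofReal (w e.1 e.2.2.1)
            ∂(M.episodeLaw (L.play n (L.obs n ω))) ∂(L.runLaw M') := by
        rw [lintegral_obs_episode _ _ _ hgm]
        refine lintegral_congr fun ω => ?_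
        exact TwoStepMDP.lintegral_episodeLaw_eq_mul hinit h₁ h₂ hw htrans _
          (hgm.comp measurable_prodMk_left)
      _ = ∫⁻ ω, ∫⁻ e, g (L.obs n ω, e) * ENNReal.ofReal (w e.1 e.2.2.1) * ENNReal.ofReal
            (∏ k : Fin n, w ((L.obs n ω).2 k).1 ((L.obs n ω).2 k).2.2.1)
            ∂(M.episodeLaw (L.play n (L.obs n ω))) ∂(L.runLaw M) := by
        refine (ih (f := fun x => ∫⁻ e, g (x, e) * ENNReal.ofReal (w e.1 e.2.2.1)
            ∂(L.nextKernel M n x)) (hgm.mul hwm).lintegral_kernel_prod_right').trans ?_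
        refine lintegral_congr fun ω => ?_
        exact (lintegral_mul_const' _ _ ENNReal.ofReal_ne_top).symm
      _ = ∫⁻ ω, g (L.obs n ω, L.episode n ω) *
            ENNReal.ofReal (w (L.episode n ω).1 (L.episode n ω).2.2.1) * ENNReal.ofReal
            (∏ k : Fin n, w ((L.obs n ω).2 k).1 ((L.obs n ω).2 k).2.2.1) ∂(L.runLaw M) :=
        (L.lintegral_obs_episode M n (f := fun p => g p *
          ENNReal.ofReal (w p.2.1 p.2.2.2.1) * ENNReal.ofReal
            (∏ k : Fin n, w (p.1.2 k).1 (p.1.2 k).2.2.1))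
          ((hgm.mul hwm).mul (hW.comp measurable_fst))).symm
      _ = _ := by
        refine lintegral_congr fun ω => ?_
        rw [mul_assoc, ← ENNReal.ofReal_mul (hw _ _), mul_comm (w _ _), obs_succ,
          Fin.prod_univ_castSucc]
        simp [hg]

end Learner

/-- A lower bound on binary relative entropies, in variational form. -/
theorem exists_binary_entropy_bound {δ : ℝ} (hδ : 0 < δ) (hδ' : δ < 5 / 12) :
    ∃ a b : ℝ, ∀ p q : ℝ, 23 / 24 - δ ≤ p → p ≤ 1 → 0 ≤ q → q ≤ δ →
      a * p + b * (1 - p) + Real.exp (-a) * q + Real.exp (-b) * (1 - q) - 1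
        ≤ -(Real.log (1 / δ) / 200) := by
  have hl2 : 0 < Real.log 2 := Real.log_pos (by norm_num)
  have hl2' : Real.log 2 < 0.6931471808 := Real.log_two_lt_d9
  have h16 : Real.log 16 = 4 * Real.log 2 := by
    rw [show (16 : ℝ) = 2 ^ 4 by norm_num, Real.log_pow]; norm_num
  rw [one_div, Real.log_inv]
  rcases le_total δ (1 / 16) with h | h
  · refine ⟨Real.log (2 * δ), Real.log 2, fun p q hp hp1 hq hqδ => ?_⟩
    rw [Real.exp_neg, Real.exp_neg, Real.exp_log (by positivity), Real.exp_log (by norm_num),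
      Real.log_mul (by norm_num) hδ.ne']
    have h1 : (2 * δ)⁻¹ * q ≤ 1 / 2 := by
      rw [inv_mul_le_iff₀ (by positivity)]; linarith
    have h2 : Real.log δ ≤ -(4 * Real.log 2) := by
      have := Real.log_le_log hδ h
      rwa [one_div, Real.log_inv, h16] at this
    have h3 : (p - 1 / 2) * (-Real.log δ) ≥ 0 := mul_nonneg (by linarith) (by linarith)
    nlinarith
  · refine ⟨Real.log (10 / 13), Real.log (14 / 11), fun p q hp hp1 hq hqδ => ?_⟩
    rw [Real.exp_neg, Real.exp_neg, Real.exp_log (by norm_num), Real.exp_log (by norm_num)]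
    have h1 : Real.log (10 / 13) ≤ 0 := Real.log_nonpos (by norm_num) (by norm_num)
    have h2 : 0 ≤ Real.log (14 / 11) := Real.log_nonneg (by norm_num)
    have h3 : 13 * Real.log (10 / 13) + 11 * Real.log (14 / 11) ≤ -(1 / 2) := by
      have : (13 : ℝ) * Real.log (10 / 13) + 11 * Real.log (14 / 11) =
          Real.log ((10 / 13) ^ 13 * (14 / 11) ^ 11) := by
        rw [Real.log_mul (by positivity) (by positivity), Real.log_pow, Real.log_pow]; norm_num
      rw [this]
      refine (Real.log_le_sub_one_of_pos (by positivity)).trans ?_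
      norm_num
    have h4 : -(4 * Real.log 2) ≤ Real.log δ := by
      have := Real.log_le_log (by norm_num) h
      rwa [one_div, Real.log_inv, h16] at this
    have h5 : (p - 13 / 24) * (Real.log (14 / 11) - Real.log (10 / 13)) ≥ 0 :=
      mul_nonneg (by linarith) (by linarith)
    nlinarith

namespace Learner
variable {S A : Type} [Fintype A] [MeasurableSpace S] [MeasurableSpace A]

/-- The seed and the first `k` episodes, as part of the seed and the first `n` episodes. -/
def truncate (L : Learner S A) {k n : ℕ} (h : k ≤ n) (x : L.Seed × (Fin n → Episode S A)) :
    L.Seed × (Fin k → Episode S A) := (x.1, fun i => x.2 (Fin.castLE h i))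

theorem measurable_truncate (L : Learner S A) {k n : ℕ} (h : k ≤ n) :
    Measurable (L.truncate h) :=
  measurable_fst.prodMk (measurable_pi_lambda _ fun i =>
    (measurable_pi_apply (Fin.castLE h i)).comp measurable_snd)

theorem truncate_obs (L : Learner S A) {k n : ℕ} (h : k ≤ n) (ω : L.Run) :
    L.truncate h (L.obs n ω) = L.obs k ω := rfl

theorem stopTime_eq_coe_iff (L : Learner S A) (ω : L.Run) (k : ℕ) :
    L.stopTime ω = k ↔ L.obs k ω ∈ L.halt k ∧ ∀ j < k, L.obs j ω ∉ L.halt j := by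
  have hle : ∀ j, L.obs j ω ∈ L.halt j → L.stopTime ω ≤ j := fun j hj => iInf₂_le j hj
  constructor
  · intro h
    have hlt : ∀ j < k, L.obs j ω ∉ L.halt j := fun j hj hmem => by
      have := hle j hmem
      rw [h] at this
      exact absurd (Nat.cast_le.1 this) (not_le.2 hj)
    refine ⟨?_, hlt⟩
    by_contra hk
    have : ((k + 1 : ℕ) : ℕ∞) ≤ L.stopTime ω := by
      refine le_iInf₂ fun j hj => Nat.cast_le.2 ?_
      by_contra hjk
      rcases (Nat.lt_succ_iff.1 (not_le.1 hjk)).lt_or_eq with h' | h'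
      · exact hlt j h' hj
      · exact hk (h' ▸ hj)
    rw [h] at this
    exact absurd (Nat.cast_le.1 this) (by simp)
  · rintro ⟨hk, hlt⟩
    refine le_antisymm (hle k hk) (le_iInf₂ fun j hj => Nat.cast_le.2 ?_)
    by_contra hjk
    exact hlt j (not_le.1 hjk) hj

/-- The event, in terms of the first `n` episodes, that the learner stops after at most `n`
episodes and outputs a policy in `Q`. -/
def stopOutput (L : Learner S A) (n : ℕ) (Q : Set (Policy S A)) :
    Set (L.Seed × (Fin n → Episode S A)) :=
  {x | ∃ k, ∃ h : k ≤ n, (L.truncate h x ∈ L.halt k ∧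
    ∀ j, ∀ hj : j < k, L.truncate (hj.le.trans h) x ∉ L.halt j) ∧
    L.output k (L.truncate h x) ∈ Q}

theorem measurableSet_stopOutput (L : Learner S A) (n : ℕ) {Q : Set (Policy S A)}
    (hQ : MeasurableSet Q) : MeasurableSet (L.stopOutput n Q) := by
  simp only [stopOutput, Set.ofPred_exists]
  refine MeasurableSet.iUnion fun k => MeasurableSet.iUnion fun h => ?_
  refine MeasurableSet.inter (MeasurableSet.inter (L.measurable_truncate h (L.measurableSet_halt k))
    ?_) ((L.measurable_output k).comp (L.measurable_truncate h) hQ)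
  change MeasurableSet {x : L.Seed × (Fin n → Episode S A) |
    ∀ j, ∀ hj : j < k, L.truncate (hj.le.trans h) x ∉ L.halt j}
  simp only [Set.ofPred_forall]
  exact MeasurableSet.iInter fun j => MeasurableSet.iInter fun hj =>
    (L.measurable_truncate _ (L.measurableSet_halt j)).compl

theorem obs_mem_stopOutput_iff (L : Learner S A) (n : ℕ) (Q : Set (Policy S A)) (ω : L.Run) :
    L.obs n ω ∈ L.stopOutput n Q ↔
      ∃ k ≤ n, L.stopTime ω = k ∧ L.output k (L.obs k ω) ∈ Q := by
  simp only [stopOutput, Set.mem_ofPred_eq, truncate_obs, stopTime_eq_coe_iff, exists_prop]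

variable [Fintype S]

/-- Markov's inequality for the number of episodes. -/
theorem measure_lt_stopTime_le (L : Learner S A) (M : TwoStepMDP S A) (n : ℕ) :
    ((n : ℝ≥0∞) + 1) * L.runLaw M {ω | ∀ k ≤ n, L.obs k ω ∉ L.halt k} ≤
      L.expectedEpisodes M := by
  have hE : MeasurableSet {ω : L.Run | ∀ k ≤ n, L.obs k ω ∉ L.halt k} := by
    simp only [Set.ofPred_forall]
    exact MeasurableSet.iInter fun k => MeasurableSet.iInter fun _ =>
      (L.measurable_obs k (L.measurableSet_halt k)).compl
  rw [← lintegral_indicator_const hE]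
  refine lintegral_mono fun ω => ?_
  by_cases hω : ω ∈ {ω : L.Run | ∀ k ≤ n, L.obs k ω ∉ L.halt k}
  · rw [Set.indicator_of_mem hω]
    have : ((n + 1 : ℕ) : ℕ∞) ≤ L.stopTime ω := by
      refine le_iInf₂ fun j hj => Nat.cast_le.2 ?_
      by_contra hjn
      exact hω j (by omega) hj
    have h2 : (((n + 1 : ℕ) : ℕ∞) : ℝ≥0∞) ≤ (L.stopTime ω : ℝ≥0∞) := by exact_mod_cast this
    simpa using h2
  · rw [Set.indicator_of_notMem hω]
    exact zero_le

variable [DiscreteMeasurableSpace S] [DiscreteMeasurableSpace A]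

/-- The data processing inequality for the relative entropy between the laws of the first `n`
episodes in two environments, applied to an event `B` and in variational form. -/
theorem sum_integral_log_le (L : Learner S A) {M M' : TwoStepMDP S A}
    {w : A → S → ℝ}
    (hinit : M'.init = M.init) (h₁ : M'.rew₁ = M.rew₁) (h₂ : M'.rew₂ = M.rew₂)
    (hw : ∀ a s, 0 < w a s)
    (htrans : ∀ a s, (M'.trans a : S → ℝ) s = (M.trans a : S → ℝ) s * w a s) (n : ℕ)
    {B : Set (L.Seed × (Fin n → Episode S A))} (hB : MeasurableSet B) (a b : ℝ) :
    ∑ k ∈ Finset.range n, ∫ ω, ∑ z, (L.play k (L.obs k ω) 0 M.init : A → ℝ) z *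
        ∑ s, (M.trans z : S → ℝ) s * Real.log (w z s) ∂(L.runLaw M) ≤
      a * (L.runLaw M).real (L.obs n ⁻¹' B) + b * (1 - (L.runLaw M).real (L.obs n ⁻¹' B)) +
        Real.exp (-a) * (L.runLaw M').real (L.obs n ⁻¹' B) +
        Real.exp (-b) * (1 - (L.runLaw M').real (L.obs n ⁻¹' B)) - 1 := by
  set P := L.runLaw M
  set P' := L.runLaw M'
  have hE : MeasurableSet (L.obs n ⁻¹' B) := L.measurable_obs n hB
  set E := L.obs n ⁻¹' B
  set W : L.Seed × (Fin n → Episode S A) → ℝ := fun x => ∏ k : Fin n, w (x.2 k).1 (x.2 k).2.2.1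
    with hWdef
  have hWm : Measurable W := Finset.measurable_prod _ fun k _ =>
    (TwoStepMDP.measurable_episode w).comp ((measurable_pi_apply k).comp measurable_snd)
  have hWpos : ∀ x, 0 < W x := fun x => Finset.prod_pos fun k _ => hw _ _
  have hWom : Measurable fun ω => W (L.obs n ω) := hWm.comp (L.measurable_obs n)
  have hcm : ∀ {C : Set (L.Seed × (Fin n → Episode S A))}, MeasurableSet C →
      P' (L.obs n ⁻¹' C) = ∫⁻ ω in L.obs n ⁻¹' C, ENNReal.ofReal (W (L.obs n ω)) ∂P := by
    intro C hC
    have := L.lintegral_obs_eq_mul hinit h₁ h₂ (fun a s => (hw a s).le) htrans n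
      (f := C.indicator 1) (measurable_one.indicator hC)
    rw [← lintegral_indicator_one (L.measurable_obs n hC),
      ← lintegral_indicator (L.measurable_obs n hC)]
    refine Eq.trans (lintegral_congr fun ω => ?_) (this.trans (lintegral_congr fun ω => ?_))
    · rfl
    · by_cases h : L.obs n ω ∈ C <;> simp [Set.indicator, h, hWdef]
  have hWint : Integrable (fun ω => W (L.obs n ω)) P := by
    refine ⟨hWom.aestronglyMeasurable, ?_⟩
    rw [hasFiniteIntegral_iff_ofReal (Filter.Eventually.of_forall fun ω => (hWpos _).le)]
    have := hcm MeasurableSet.univ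
    simp only [Set.preimage_univ, Measure.restrict_univ, measure_univ] at this
    rw [← this]
    exact ENNReal.one_lt_top
  have hreal : ∀ {C : Set (L.Seed × (Fin n → Episode S A))}, MeasurableSet C →
      P'.real (L.obs n ⁻¹' C) = ∫ ω in L.obs n ⁻¹' C, W (L.obs n ω) ∂P := by
    intro C hC
    rw [Measure.real, hcm hC, integral_eq_lintegral_of_nonneg_ae
      (Filter.Eventually.of_forall fun ω => (hWpos _).le) hWom.aestronglyMeasurable]
  set Z : L.Run → ℝ := fun ω =>
    ∑ k ∈ Finset.range n, Real.log (w (L.episode k ω).1 (L.episode k ω).2.2.1) with hZ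
  have hZW : ∀ ω, Real.exp (Z ω) = W (L.obs n ω) := by
    intro ω
    rw [hZ]
    simp only
    rw [Real.exp_sum, Finset.prod_range]
    exact Finset.prod_congr rfl fun k _ => Real.exp_log (hw _ _)
  obtain ⟨C, hC⟩ := TwoStepMDP.exists_bound_episode fun a s => Real.log (w a s)
  have hk : ∀ k, Integrable
      (fun ω => Real.log (w (L.episode k ω).1 (L.episode k ω).2.2.1)) P := fun k =>
    Integrable.of_bound ((TwoStepMDP.measurable_episode fun a s => Real.log (w a s)).comp
      (L.measurable_episode k)).aestronglyMeasurable C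
      (Filter.Eventually.of_forall fun ω => hC _)
  have hZint : Integrable Z P := integrable_finsetSum _ fun k _ => hk k
  have hsum : ∑ k ∈ Finset.range n, ∫ ω, ∑ z, (L.play k (L.obs k ω) 0 M.init : A → ℝ) z *
        ∑ s, (M.trans z : S → ℝ) s * Real.log (w z s) ∂P = ∫ ω, Z ω ∂P := by
    rw [integral_finsetSum _ fun k _ => hk k]
    exact Finset.sum_congr rfl fun k _ => (L.integral_episode M k _).symm
  have hpt : ∀ c ω, Z ω ≤ Real.exp (-c) * W (L.obs n ω) + (c - 1) := by
    intro c ω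
    have := Real.add_one_le_exp (Z ω - c)
    rw [sub_eq_neg_add, Real.exp_add, hZW] at this
    linarith
  have hset : ∀ c, ∀ F : Set L.Run, MeasurableSet F → ∫ ω in F, Z ω ∂P ≤
      Real.exp (-c) * ∫ ω in F, W (L.obs n ω) ∂P + (c - 1) * P.real F := by
    intro c F hF
    calc ∫ ω in F, Z ω ∂P ≤ ∫ ω in F, (Real.exp (-c) * W (L.obs n ω) + (c - 1)) ∂P :=
          integral_mono hZint.integrableOn
            ((hWint.integrableOn.const_mul _).add (integrable_const _)) fun ω => hpt c ω
      _ = _ := by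
          rw [integral_add (hWint.integrableOn.const_mul _) (integrable_const _),
            integral_const_mul, setIntegral_const, smul_eq_mul, mul_comm (c - 1)]
  have hEa := hset a E hE
  have hEb := hset b Eᶜ hE.compl
  rw [← hreal hB] at hEa
  rw [show Eᶜ = L.obs n ⁻¹' Bᶜ from rfl, ← hreal hB.compl] at hEb
  rw [show L.obs n ⁻¹' Bᶜ = Eᶜ from rfl, probReal_compl_eq_one_sub hE,
    probReal_compl_eq_one_sub hE] at hEb
  rw [hsum, ← integral_add_compl hE hZint]
  linarith

/-- The information needed to tell apart two environments with disjoint sets of valid outputs. -/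
theorem sum_integral_log_le_of_disjoint_outputs (L : Learner S A) {M M' : TwoStepMDP S A}
    {w : A → S → ℝ}
    (hinit : M'.init = M.init) (h₁ : M'.rew₁ = M.rew₁) (h₂ : M'.rew₂ = M.rew₂)
    (hw : ∀ a s, 0 < w a s)
    (htrans : ∀ a s, (M'.trans a : S → ℝ) s = (M.trans a : S → ℝ) s * w a s) (n : ℕ)
    {Q : Set (Policy S A)} (hQ : MeasurableSet Q) {δ : ℝ} (hδ : 0 < δ) (hδ' : δ < 5 / 12)
    (hM : ENNReal.ofReal (1 - δ) ≤
      L.runLaw M {ω | ∃ k : ℕ, L.stopTime ω = k ∧ L.output k (L.obs k ω) ∈ Q})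
    (hM' : ENNReal.ofReal (1 - δ) ≤
      L.runLaw M' {ω | ∃ k : ℕ, L.stopTime ω = k ∧ L.output k (L.obs k ω) ∉ Q})
    (hK : L.expectedEpisodes M ≤ ENNReal.ofReal (((n : ℝ) + 1) / 24)) :
    ∑ k ∈ Finset.range n, ∫ ω, ∑ z, (L.play k (L.obs k ω) 0 M.init : A → ℝ) z *
        ∑ s, (M.trans z : S → ℝ) s * Real.log (w z s) ∂(L.runLaw M) ≤
      -(Real.log (1 / δ) / 200) := by
  obtain ⟨a, b, hab⟩ := exists_binary_entropy_bound hδ hδ'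
  have hB := L.measurableSet_stopOutput n hQ
  refine (L.sum_integral_log_le hinit h₁ h₂ hw htrans n hB a b).trans ?_
  have hE : MeasurableSet (L.obs n ⁻¹' L.stopOutput n Q) := L.measurable_obs n hB
  refine hab _ _ ?_ measureReal_le_one measureReal_nonneg ?_
  · have h1 : L.runLaw M {ω | ∀ k ≤ n, L.obs k ω ∉ L.halt k} ≤ ENNReal.ofReal (1 / 24) := by
      have h := (L.measure_lt_stopTime_le M n).trans hK
      rw [div_eq_mul_one_div, ENNReal.ofReal_mul (by positivity),
        ENNReal.ofReal_add (by positivity) zero_le_one, ENNReal.ofReal_natCast,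
        ENNReal.ofReal_one] at h
      exact (ENNReal.mul_le_mul_iff_right (by simp) (by simp)).1 h
    have h2 : {ω | ∃ k : ℕ, L.stopTime ω = k ∧ L.output k (L.obs k ω) ∈ Q} ⊆
        (L.obs n ⁻¹' L.stopOutput n Q) ∪ {ω | ∀ k ≤ n, L.obs k ω ∉ L.halt k} := by
      rintro ω ⟨k, hk, hkQ⟩
      by_cases hkn : k ≤ n
      · exact Or.inl ((L.obs_mem_stopOutput_iff n Q ω).2 ⟨k, hkn, hk, hkQ⟩)
      · exact Or.inr fun j hj => ((L.stopTime_eq_coe_iff ω k).1 hk).2 j (by omega)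
    have h3 := hM.trans ((measure_mono h2).trans (measure_union_le _ _))
    have h4 := h3.trans (add_le_add_right h1 _)
    rw [← ofReal_measureReal, ← ENNReal.ofReal_add measureReal_nonneg (by norm_num),
      ENNReal.ofReal_le_ofReal_iff (by positivity)] at h4
    linarith
  · have h1 : {ω | ∃ k : ℕ, L.stopTime ω = k ∧ L.output k (L.obs k ω) ∉ Q} ⊆
        (L.obs n ⁻¹' L.stopOutput n Q)ᶜ := by
      rintro ω ⟨k, hk, hkQ⟩ hω
      obtain ⟨j, -, hj, hjQ⟩ := (L.obs_mem_stopOutput_iff n Q ω).1 hω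
      rw [hk] at hj
      obtain rfl : k = j := by exact_mod_cast hj
      exact hkQ hjQ
    have h2 := hM'.trans (measure_mono h1)
    rw [← ofReal_measureReal, ENNReal.ofReal_le_ofReal_iff measureReal_nonneg,
      probReal_compl_eq_one_sub hE] at h2
    linarith

end Learner

/-- Features which span the space have a positive definite covariance. -/
theorem exists_pos_mul_norm_sq_le {ι E : Type*} [Fintype ι] [NormedAddCommGroup E]
    [InnerProductSpace ℝ E] [FiniteDimensional ℝ E] (p : ι → ℝ) (hp : ∀ i, 0 ≤ p i) (x : ι → E)
    (hx : ∀ w : E, (∀ i, p i = 0 ∨ inner ℝ (x i) w = 0) → w = 0) :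
    ∃ lam > (0 : ℝ), ∀ w : E, lam * ‖w‖ ^ 2 ≤ ∑ i, p i * (inner ℝ (x i) w) ^ 2 := by
  have hcont : Continuous fun w : E => ∑ i, p i * (inner ℝ (x i) w) ^ 2 := by fun_prop
  have hnn : ∀ w : E, ∀ i ∈ Finset.univ, 0 ≤ p i * (inner ℝ (x i) w) ^ 2 :=
    fun w i _ => mul_nonneg (hp i) (sq_nonneg _)
  rcases (Metric.sphere (0 : E) 1).eq_empty_or_nonempty with he | hne
  · refine ⟨1, one_pos, fun w => ?_⟩
    have hw : w = 0 := by
      by_contra hw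
      have : ‖w‖⁻¹ • w ∈ Metric.sphere (0 : E) 1 := by
        simp [norm_smul, norm_ne_zero_iff.2 hw]
      rw [he] at this
      exact this
    simp [hw]
  · obtain ⟨w₀, hw₀, hmin⟩ := (isCompact_sphere (0 : E) 1).exists_isMinOn hne hcont.continuousOn
    have hw₀' : ‖w₀‖ = 1 := by simpa using hw₀
    refine ⟨∑ i, p i * (inner ℝ (x i) w₀) ^ 2, ?_, fun w => ?_⟩
    · refine lt_of_le_of_ne (Finset.sum_nonneg (hnn w₀)) fun h => ?_
      have h0 := (Finset.sum_eq_zero_iff_of_nonneg (hnn w₀)).1 h.symm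
      have : w₀ = 0 := hx w₀ fun i => by simpa using h0 i (Finset.mem_univ i)
      simp [this] at hw₀'
    · rcases eq_or_ne w 0 with rfl | hw
      · simp
      have hn : ‖w‖ ≠ 0 := norm_ne_zero_iff.2 hw
      have hmem : ‖w‖⁻¹ • w ∈ Metric.sphere (0 : E) 1 := by simp [norm_smul, hn]
      have h1 := isMinOn_iff.1 hmin _ hmem
      have h2 : ∑ i, p i * (inner ℝ (x i) (‖w‖⁻¹ • w)) ^ 2 =
          (∑ i, p i * (inner ℝ (x i) w) ^ 2) / ‖w‖ ^ 2 := by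
        rw [Finset.sum_div]
        refine Finset.sum_congr rfl fun i _ => ?_
        rw [inner_smul_right]
        field_simp
      rw [h2] at h1
      exact (le_div_iff₀ (by positivity)).1 h1

namespace BanditMDP

theorem sum_state {d : ℕ} {E : Type*} [AddCommMonoid E] (f : State d → E) :
    ∑ s, f s = f .start + f .good + ∑ i, f (.bad i) := by
  let e : Option (Option (Fin d)) ≃ State d :=
    { toFun := fun x => match x with
        | none => .start
        | some none => .good
        | some (some i) => .bad i
      invFun := fun s => match s with
        | .start => none
        | .good => some none
        | .bad i => some (some i)
      left_inv := by rintro (_ | _ | _) <;> rfl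
      right_inv := by rintro (_ | _ | _) <;> rfl }
  rw [← e.sum_comp, Fintype.sum_option, Fintype.sum_option, add_assoc]
  rfl

theorem sum_arm {d : ℕ} {E : Type*} [AddCommMonoid E] (f : Arm d → E) :
    ∑ a, f a = f .best + f .null + (∑ i, f (.basis i) + ∑ i, f (.near i)) := by
  let e : Option (Option ({j : Fin d // (j : ℕ) ≠ 0} ⊕ {j : Fin d // (j : ℕ) ≠ 0})) ≃ Arm d :=
    { toFun := fun x => match x with
        | none => .best
        | some none => .null
        | some (some (.inl i)) => .basis i
        | some (some (.inr i)) => .near i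
      invFun := fun s => match s with
        | .best => none
        | .null => some none
        | .basis i => some (some (.inl i))
        | .near i => some (some (.inr i))
      left_inv := by rintro (_ | _ | _ | _) <;> rfl
      right_inv := by rintro (_ | _ | _ | _) <;> rfl }
  rw [← e.sum_comp, Fintype.sum_option, Fintype.sum_option, Fintype.sum_sum_type, add_assoc]
  rfl

variable {d : ℕ} {u v Δ : ℝ} {θ : Fin d → ℝ}

/-- The mean reward `1 / 2 + ⟨θ, z⟩` of an arm `z`. -/
def armMean (d : ℕ) (Δ : ℝ) (θ : Fin d → ℝ) (a : Arm d) : ℝ := 1 / 2 + ∑ j, vec d Δ a j * θ j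

/-- The transition vectors for the bandit parameter `θ`. -/
def transVecOf (d : ℕ) (u v : ℝ) (θ : Fin d → ℝ) : State d → EuclideanSpace ℝ (Fin (d + 1))
  | .start => 0
  | .good => WithLp.toLp 2 (Fin.snoc (α := fun _ => ℝ) (fun j => θ j / u) (1 / (2 * v)))
  | .bad _ => (1 / (d : ℝ)) •
      WithLp.toLp 2 (Fin.snoc (α := fun _ => ℝ) (fun j => -(θ j / u)) (1 / (2 * v)))

/-- The transition probabilities for the bandit parameter `θ`. -/
def transProb (d : ℕ) (Δ : ℝ) (θ : Fin d → ℝ) (a : Arm d) : State d → ℝ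
  | .start => 0
  | .good => armMean d Δ θ a
  | .bad _ => (1 - armMean d Δ θ a) / d

theorem inner_feat_transVecOf (hu : u ≠ 0) (hv : v ≠ 0) (a : Arm d) (s : State d) :
    inner ℝ (feat d u v Δ .start a) (transVecOf d u v θ s) = transProb d Δ θ a s := by
  have h1 : ∀ j, θ j / u * (u * vec d Δ a j) = vec d Δ a j * θ j := fun j => by field_simp
  have h2 : v⁻¹ * 2⁻¹ * v = 1 / 2 := by field_simp
  cases s with
  | start => simp [transVecOf, transProb]
  | good =>
    simp [transVecOf, transProb, feat, PiLp.inner_apply, Fin.sum_univ_castSucc, armMean, h1, h2]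
    ring
  | bad i =>
    simp [transVecOf, transProb, feat, PiLp.inner_apply, Fin.sum_univ_castSucc, armMean, h1, h2,
      inner_smul_right]
    ring

theorem inner_feat_single_good (a : Arm d) :
    inner ℝ (feat d u v Δ .good a) (EuclideanSpace.single 0 1) = (1 : ℝ) := by
  simp [feat]

theorem inner_feat_single_bad (i : Fin d) (a : Arm d) :
    inner ℝ (feat d u v Δ (.bad i) a) (EuclideanSpace.single 0 1) = (0 : ℝ) := by
  simp [feat, EuclideanSpace.inner_single_left]

theorem ξ_pos (hd : 0 < d) : 0 < ξ d := by
  have : (0 : ℝ) < d := by exact_mod_cast hd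
  unfold ξ; positivity

theorem ξ_le (hd : 0 < d) : ξ d ≤ 1 / 52 := by
  have : (1 : ℝ) ≤ d := by exact_mod_cast hd
  unfold ξ
  exact one_div_le_one_div_of_le (by norm_num) (by linarith)

theorem γ_pos (hd : 0 < d) : 0 < γ d := by
  have : (0 : ℝ) < d := by exact_mod_cast hd
  unfold γ; positivity

theorem γ_le (hd : 0 < d) : γ d ≤ 1 / 52 := by
  have : 1 ≤ √(d : ℝ) := Real.one_le_sqrt.2 (by exact_mod_cast hd)
  unfold γ
  exact one_div_le_one_div_of_le (by norm_num) (by linarith)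

theorem inner_feat_single_start_mem (hd : 0 < d) (hu : 0 < u) (hu1 : u ≤ 1) (hΔ : 0 < Δ)
    (hΔ' : Δ ≤ ξ d) (a : Arm d) :
    inner ℝ (feat d u v Δ .start a) (EuclideanSpace.single 0 1) ∈ Set.Icc (0 : ℝ) 1 := by
  have h0 : inner ℝ (feat d u v Δ .start a) (EuclideanSpace.single 0 1) =
      u * vec d Δ a ⟨0, hd⟩ := by
    have h : feat d u v Δ .start a (Fin.castSucc ⟨0, hd⟩) = u * vec d Δ a ⟨0, hd⟩ := by
      simp only [feat, Fin.snoc_castSucc]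
    rw [EuclideanSpace.inner_single_right]
    simpa using h
  have hξ := ξ_pos hd
  have hξ' := ξ_le hd
  have hv : vec d Δ a ⟨0, hd⟩ ∈ Set.Icc (0 : ℝ) 1 := by
    cases a with
    | best => simp only [vec, if_true]; constructor <;> linarith
    | null => simp [vec]
    | basis i => simp only [vec]; split_ifs <;> simp
    | near i => simp only [vec, if_true]; constructor <;> linarith
  rw [h0]
  exact ⟨mul_nonneg hu.le hv.1, mul_le_one₀ hu1 hv.1 hv.2⟩

theorem transProb_mem (hd : 0 < d) (hm : ∀ a, armMean d Δ θ a ∈ Set.Ioo (0 : ℝ) 1) (a : Arm d) :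
    transProb d Δ θ a ∈ stdSimplex ℝ (State d) := by
  have hd' : (0 : ℝ) < d := by exact_mod_cast hd
  refine ⟨fun s => ?_, ?_⟩
  · cases s with
    | start => exact le_rfl
    | good => exact (hm a).1.le
    | bad i => exact div_nonneg (by linarith [(hm a).2]) hd'.le
  · rw [sum_state]
    simp only [transProb, Finset.sum_const, Finset.card_univ, Fintype.card_fin, nsmul_eq_mul]
    field_simp
    ring

theorem norm_feat_le (hd : 0 < d) (hΔ : 0 < Δ) (hΔ' : Δ ≤ ξ d) (huv : u ^ 2 + v ^ 2 ≤ 1)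
    (s : State d) (a : Arm d) :
    ‖feat d u v Δ s a‖ ≤ 1 := by
  cases s with
  | good => simp [feat]
  | bad i => simp [feat]
  | start =>
    have hξ := ξ_pos hd
    have hξ' := ξ_le hd
    have hγ := γ_pos hd
    have hγ' := γ_le hd
    have hvec : ∑ j, vec d Δ a j ^ 2 ≤ 1 := by
      cases a with
      | best =>
        have : ∀ j : Fin d, (j : ℕ) = 0 ↔ j = ⟨0, hd⟩ := fun j => by simp [Fin.ext_iff]
        simp only [vec, this, ite_pow, zero_pow two_ne_zero, Finset.sum_ite_eq', Finset.mem_univ,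
          if_true]
        nlinarith
      | null => simp [vec]
      | basis i => simp [vec]
      | near i =>
        have : ∀ j : Fin d, vec d Δ (.near i) j ^ 2 =
            (if j = ⟨0, hd⟩ then (ξ d - Δ) ^ 2 else 0) + if j = i.1 then γ d ^ 2 else 0 := by
          intro j
          have hi := i.2
          simp only [vec]
          by_cases h0 : (j : ℕ) = 0
          · have h1 : j = ⟨0, hd⟩ := Fin.ext h0
            have h2 : j ≠ i.1 := fun h => hi (h ▸ h0)
            rw [if_pos h0, if_pos h1, if_neg h2, add_zero]
          · have h1 : j ≠ ⟨0, hd⟩ := fun h => h0 (by rw [h])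
            rw [if_neg h0, if_neg h1, zero_add]
            split_ifs <;> simp
        simp only [this, Finset.sum_add_distrib, Finset.sum_ite_eq', Finset.mem_univ, if_true]
        nlinarith
    rw [← sq_le_one_iff₀ (norm_nonneg _), EuclideanSpace.real_norm_sq_eq, Fin.sum_univ_castSucc]
    simp only [feat, Fin.snoc_castSucc, Fin.snoc_last, mul_pow, ← Finset.mul_sum]
    nlinarith [sq_nonneg u]

/-- The linear MDP built from the linear bandit with parameter `θ`. -/
def mdp (d : ℕ) (u v Δ : ℝ) (θ : Fin d → ℝ) (hd : 0 < d) (hu : 0 < u) (hu1 : u ≤ 1) (hΔ : 0 < Δ)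
    (hΔ' : Δ ≤ ξ d) (hm : ∀ a, armMean d Δ θ a ∈ Set.Ioo (0 : ℝ) 1) :
    TwoStepMDP (State d) (Arm d) where
  init := .start
  trans a := ⟨transProb d Δ θ a, transProb_mem hd hm a⟩
  rew₁ _ := Measure.dirac 0
  rew₂ s a := Measure.dirac (inner ℝ (feat d u v Δ s a) (EuclideanSpace.single 0 1))
  rew₁_prob _ := inferInstance
  rew₂_prob _ _ := inferInstance
  rew₁_mem _ := by rw [ae_dirac_eq]; simp
  rew₂_mem s a := by
    rw [ae_dirac_eq]
    cases s with
    | start => exact inner_feat_single_start_mem hd hu hu1 hΔ hΔ' a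
    | good => simp [inner_feat_single_good]
    | bad i => simp [inner_feat_single_bad]

section mdp

variable (hd : 0 < d) (hu : 0 < u) (hu1 : u ≤ 1) (hΔ : 0 < Δ) (hΔ' : Δ ≤ ξ d)
  (hm : ∀ a, armMean d Δ θ a ∈ Set.Ioo (0 : ℝ) 1)

theorem value_mdp (π : Policy (State d) (Arm d)) :
    (mdp d u v Δ θ hd hu hu1 hΔ hΔ' hm).value π =
      ∑ a, (π 0 .start : Arm d → ℝ) a * armMean d Δ θ a := by
  have hs : ∀ s, ∑ a', (π 1 s : Arm d → ℝ) a' = 1 := fun s => (π 1 s).2.2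
  simp only [TwoStepMDP.value, mdp, integral_dirac, zero_add, sum_state,
    inner_feat_single_good, inner_feat_single_bad]
  simp only [mul_zero, Finset.sum_const_zero, mul_one, hs, add_zero]
  refine Finset.sum_congr rfl fun a _ => congrArg _ ?_
  change 0 * _ + armMean d Δ θ a = _
  rw [zero_mul, zero_add]

theorem value_mdp_le_one (π : Policy (State d) (Arm d)) :
    (mdp d u v Δ θ hd hu hu1 hΔ hΔ' hm).value π ≤ 1 := by
  rw [value_mdp]
  calc _ ≤ ∑ a, (π 0 .start : Arm d → ℝ) a * 1 :=
        Finset.sum_le_sum fun a _ => mul_le_mul_of_nonneg_left (hm a).2.le ((π 0 .start).2.1 a)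
    _ = 1 := by simp only [mul_one]; exact (π 0 .start).2.2

theorem armMean_le_optValue (b : Arm d) :
    armMean d Δ θ b ≤ (mdp d u v Δ θ hd hu hu1 hΔ hΔ' hm).optValue := by
  let π : Policy (State d) (Arm d) := fun _ _ => ⟨Pi.single b 1, single_mem_stdSimplex ℝ b⟩
  have hπ : (mdp d u v Δ θ hd hu hu1 hΔ hΔ' hm).value π = armMean d Δ θ b := by
    rw [value_mdp]
    simp [π, Pi.single_apply]
  rw [← hπ]
  exact le_ciSup (f := fun π => (mdp d u v Δ θ hd hu hu1 hΔ hΔ' hm).value π)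
    ⟨1, by rintro _ ⟨π, rfl⟩; exact value_mdp_le_one hd hu hu1 hΔ hΔ' hm π⟩ π

theorem sum_gap_le (b : Arm d) (π : Policy (State d) (Arm d)) :
    ∑ a, (π 0 .start : Arm d → ℝ) a * (armMean d Δ θ b - armMean d Δ θ a) ≤
      (mdp d u v Δ θ hd hu hu1 hΔ hΔ' hm).optValue -
        (mdp d u v Δ θ hd hu hu1 hΔ hΔ' hm).value π := by
  have h := armMean_le_optValue hd hu hu1 hΔ hΔ' (v := v) hm b
  have hs : ∑ a, (π 0 .start : Arm d → ℝ) a = 1 := (π 0 .start).2.2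
  rw [value_mdp]
  simp only [mul_sub, Finset.sum_sub_distrib, ← Finset.sum_mul, hs]
  linarith

theorem isLinear_mdp (hv : 0 < v) (huv : u ^ 2 + v ^ 2 ≤ 1)
    (hθ : 4 * (∑ j, θ j ^ 2) / u ^ 2 + 1 / v ^ 2 ≤ (d : ℝ) + 1) :
    (mdp d u v Δ θ hd hu hu1 hΔ hΔ' hm).IsLinear .start (feat d u v Δ) := by
  have hd' : (0 : ℝ) < d := by exact_mod_cast hd
  refine ⟨rfl, norm_feat_le hd hΔ hΔ' huv, transVecOf d u v θ, 0, EuclideanSpace.single 0 1,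
    fun a s => (inner_feat_transVecOf hu.ne' hv.ne' a s).symm, fun a => ?_, fun s a => ?_,
    ?_, ?_, ?_⟩
  · simp [mdp]
  · simp [mdp]
  · refine Real.le_sqrt_of_sq_le ?_
    rw [EuclideanSpace.real_norm_sq_eq, Fin.sum_univ_castSucc]
    have h1 : ∀ j : Fin d, ∑ s, |transVecOf d u v θ s j.castSucc| = 2 * |θ j| / u := by
      intro j
      rw [sum_state]
      simp [transVecOf, abs_mul, abs_div, abs_of_pos hu]
      field_simp
      ring
    have h2 : ∑ s, |transVecOf d u v θ s (Fin.last d)| = 1 / v := by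
      rw [sum_state]
      simp [transVecOf, abs_mul, abs_of_pos hv]
      field_simp
      ring
    simp only [h1, h2]
    push_cast
    refine le_trans (le_of_eq ?_) hθ
    simp only [div_pow, mul_pow, sq_abs, ← Finset.sum_div, ← Finset.mul_sum]
    norm_num
  · simp
  · simp only [PiLp.norm_single, norm_one]
    exact Real.one_le_sqrt.2 (by push_cast; linarith)

theorem fullRank_mdp (hv : 0 < v) :
    (mdp d u v Δ θ hd hu hu1 hΔ hΔ' hm).FullRank (feat d u v Δ) := by
  have hd' : (0 : ℝ) < d := by exact_mod_cast hd
  have hne : Nonempty (Arm d) := ⟨.best⟩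
  have hcard : (0 : ℝ) < Fintype.card (Arm d) := by exact_mod_cast Fintype.card_pos
  let unif : stdSimplex ℝ (Arm d) := ⟨fun _ => 1 / Fintype.card (Arm d),
    fun _ => by positivity, by simp [hcard.ne']⟩
  have hun : ∀ a, (unif : Arm d → ℝ) a = 1 / Fintype.card (Arm d) := fun a => rfl
  let π : Policy (State d) (Arm d) := fun _ _ => unif
  constructor
  · obtain ⟨lam, hlam, h⟩ := exists_pos_mul_norm_sq_le (unif : Arm d → ℝ) (fun a => unif.2.1 a)
      (fun a => feat d u v Δ .start a) (by
      intro w hw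
      have hz : ∀ a, inner ℝ (feat d u v Δ .start a) w = (0 : ℝ) := fun a =>
        (hw a).resolve_left (by rw [hun]; positivity)
      have hlast : w (Fin.last d) = 0 := by
        have := hz .null
        simpa [feat, PiLp.inner_apply, Fin.sum_univ_castSucc, vec, hv.ne'] using this
      have hcs : ∀ j : Fin d, w j.castSucc = 0 := by
        intro j
        by_cases h0 : (j : ℕ) = 0
        · have := hz .best
          have hj : ∀ j : Fin d, (j : ℕ) = 0 ↔ j = ⟨0, hd⟩ := fun j => by simp [Fin.ext_iff]
          simpa [feat, PiLp.inner_apply, Fin.sum_univ_castSucc, vec, hlast, hj, hu.ne',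
            (ξ_pos hd).ne', (hj j).1 h0] using this
        · have := hz (.basis ⟨j, h0⟩)
          simpa [feat, PiLp.inner_apply, Fin.sum_univ_castSucc, vec, hlast, hu.ne'] using this
      ext j
      induction j using Fin.lastCases with
      | last => exact hlast
      | cast j => exact hcs j)
    exact ⟨π, lam, hlam, h⟩
  · obtain ⟨lam, hlam, h⟩ := exists_pos_mul_norm_sq_le
      (fun x : Arm d × State d × Arm d => (unif : Arm d → ℝ) x.1 *
        (transProb d Δ θ x.1 x.2.1 * (unif : Arm d → ℝ) x.2.2))
      (fun x => mul_nonneg (unif.2.1 _) (mul_nonneg ((transProb_mem hd hm _).1 _) (unif.2.1 _)))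
      (fun x => feat d u v Δ x.2.1 x.2.2) (by
      intro w hw
      have hz : ∀ s, transProb d Δ θ .best s ≠ 0 →
          inner ℝ (feat d u v Δ s .best) w = (0 : ℝ) := fun s hs =>
        (hw (.best, s, .best)).resolve_left (by
          simp only [hun]
          exact mul_ne_zero (by positivity) (mul_ne_zero hs (by positivity)))
      ext j
      induction j using Fin.cases with
      | zero => simpa [feat, EuclideanSpace.inner_single_left] using hz .good (hm _).1.ne'
      | succ j =>
        have hb : transProb d Δ θ .best (.bad j) ≠ 0 :=
          (div_pos (by linarith [(hm .best).2]) hd').ne'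
        simpa [feat, EuclideanSpace.inner_single_left] using hz (.bad j) hb)
    refine ⟨π, lam, hlam, fun w => (h w).trans (le_of_eq ?_)⟩
    simp only [Fintype.sum_prod_type, Finset.mul_sum, mul_assoc]
    rfl

theorem mdp_mem_environments (hv : 0 < v) (huv : u ^ 2 + v ^ 2 ≤ 1)
    (hθ : 4 * (∑ j, θ j ^ 2) / u ^ 2 + 1 / v ^ 2 ≤ (d : ℝ) + 1) :
    mdp d u v Δ θ hd hu hu1 hΔ hΔ' hm ∈ environments d u v Δ :=
  ⟨isLinear_mdp hd hu hu1 hΔ hΔ' hm hv huv hθ, fullRank_mdp hd hu hu1 hΔ hΔ' hm hv⟩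

end mdp

end BanditMDP

/-- The relative entropy between Bernoulli laws is at most a multiple of the squared difference of
their means, away from the boundary. -/
theorem neg_sq_sub_le_bernoulli {p q : ℝ} (hp : 0 < p) (hp1 : p < 1) (hq : 1 / 4 ≤ q)
    (hq1 : q ≤ 3 / 4) :
    -(6 * (p - q) ^ 2) ≤ p * Real.log (q / p) + (1 - p) * Real.log ((1 - q) / (1 - p)) := by
  have hq0 : 0 < q := by linarith
  have hq0' : 0 < 1 - q := by linarith
  have hp0' : 0 < 1 - p := by linarith
  have h1 := Real.one_sub_inv_le_log_of_pos (div_pos hq0 hp)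
  have h2 := Real.one_sub_inv_le_log_of_pos (div_pos hq0' hp0')
  have h3 := mul_le_mul_of_nonneg_left h1 hp.le
  have h4 := mul_le_mul_of_nonneg_left h2 hp0'.le
  have h5 : p * (1 - (q / p)⁻¹) + (1 - p) * (1 - ((1 - q) / (1 - p))⁻¹) =
      -((p - q) ^ 2 / (q * (1 - q))) := by
    rw [inv_div, inv_div]
    field_simp
    ring
  have h6 : (p - q) ^ 2 / (q * (1 - q)) ≤ 6 * (p - q) ^ 2 := by
    rw [div_le_iff₀ (by positivity)]
    have : 1 / 6 ≤ q * (1 - q) := by nlinarith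
    nlinarith [sq_nonneg (p - q)]
  linarith

theorem exists_forall_rpow_add_lt (C₁ C₂ K α : ℝ) {a : ℝ} (hα : α < 1) (ha : 0 < a) :
    ∃ X₀ ≥ (1 : ℝ), ∀ X ≥ X₀, 1 ≤ a * X ∧ K * (C₁ * (a * X) ^ α + C₂) < X := by
  have h1 : Filter.Tendsto (fun X : ℝ => a * X) Filter.atTop Filter.atTop :=
    Filter.tendsto_id.const_mul_atTop ha
  have h2 : Filter.Tendsto (fun X : ℝ => X ^ (-(1 - α))) Filter.atTop (nhds 0) :=
    tendsto_rpow_neg_atTop (by linarith)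
  have h3 : Filter.Tendsto (fun X : ℝ => K * (C₁ * a ^ α) * X ^ (-(1 - α)) + K * C₂ * X⁻¹)
      Filter.atTop (nhds 0) := by
    simpa using (h2.const_mul (K * (C₁ * a ^ α))).add
      (tendsto_inv_atTop_zero.const_mul (K * C₂))
  obtain ⟨X₀, hX₀⟩ := Filter.eventually_atTop.1 ((h1.eventually_ge_atTop 1).and
    (h3.eventually_lt_const one_pos))
  refine ⟨max X₀ 1, le_max_right _ _, fun X hX => ?_⟩
  obtain ⟨hX1, hX2⟩ := hX₀ X ((le_max_left _ _).trans hX)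
  have hX0 : 0 < X := one_pos.trans_le ((le_max_right _ _).trans hX)
  refine ⟨hX1, ?_⟩
  have h4 := mul_lt_mul_of_pos_right hX2 hX0
  rw [one_mul] at h4
  refine lt_of_eq_of_lt ?_ h4
  have h5 : X ^ (-(1 - α)) * X = X ^ α := by
    rw [← Real.rpow_add_one hX0.ne']; ring_nf
  rw [Real.mul_rpow ha.le hX0.le, ← h5]
  field_simp

namespace BanditMDP

instance (d : ℕ) : DiscreteMeasurableSpace (State d) := ⟨fun _ => trivial⟩
instance (d : ℕ) : DiscreteMeasurableSpace (Arm d) := ⟨fun _ => trivial⟩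

variable {d : ℕ} {u v Δ κ η : ℝ} {θ θ' : Fin d → ℝ}

/-- The bandit parameter `κ e₁`. -/
def baseParam (d : ℕ) (κ : ℝ) (j : Fin d) : ℝ := if (j : ℕ) = 0 then κ else 0

/-- The perturbed bandit parameter `κ e₁ + η e_i`. -/
def altParam (d : ℕ) (κ η : ℝ) (i : {j : Fin d // (j : ℕ) ≠ 0}) (j : Fin d) : ℝ :=
  baseParam d κ j + if j = i.1 then η else 0

theorem baseParam_eq_single (hd : 0 < d) (j : Fin d) :
    baseParam d κ j = if j = ⟨0, hd⟩ then κ else 0 := by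
  simp [baseParam, Fin.ext_iff]

theorem armMean_baseParam (hd : 0 < d) (a : Arm d) :
    armMean d Δ (baseParam d κ) a = 1 / 2 + vec d Δ a ⟨0, hd⟩ * κ := by
  simp [armMean, baseParam_eq_single hd]

theorem armMean_altParam (i : {j : Fin d // (j : ℕ) ≠ 0}) (a : Arm d) :
    armMean d Δ (altParam d κ η i) a = armMean d Δ (baseParam d κ) a + vec d Δ a i.1 * η := by
  simp [armMean, altParam, mul_add, Finset.sum_add_distrib, add_assoc]

theorem armMean_baseParam_best (hd : 0 < d) :
    armMean d Δ (baseParam d κ) .best = 1 / 2 + κ * ξ d := by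
  rw [armMean_baseParam hd]; simp [vec, mul_comm]

theorem armMean_baseParam_null : armMean d Δ (baseParam d κ) .null = 1 / 2 := by
  simp [armMean, vec]

theorem armMean_baseParam_basis (hd : 0 < d) (i : {j : Fin d // (j : ℕ) ≠ 0}) :
    armMean d Δ (baseParam d κ) (.basis i) = 1 / 2 := by
  have h : (⟨0, hd⟩ : Fin d) ≠ i.1 := fun h => i.2 (h ▸ rfl)
  rw [armMean_baseParam hd]; simp [vec, h]

theorem armMean_baseParam_near (hd : 0 < d) (i : {j : Fin d // (j : ℕ) ≠ 0}) :
    armMean d Δ (baseParam d κ) (.near i) = 1 / 2 + κ * ξ d - κ * Δ := by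
  rw [armMean_baseParam hd]; simp [vec]; ring

theorem vec_best_coe (i : {j : Fin d // (j : ℕ) ≠ 0}) : vec d Δ .best i.1 = 0 := by
  simp [vec, i.2]

theorem vec_basis_coe (i i' : {j : Fin d // (j : ℕ) ≠ 0}) :
    vec d Δ (.basis i') i.1 = if i' = i then 1 else 0 := by
  simp [vec, Subtype.ext_iff, eq_comm]

theorem vec_near_coe (i i' : {j : Fin d // (j : ℕ) ≠ 0}) :
    vec d Δ (.near i') i.1 = if i' = i then γ d else 0 := by
  simp [vec, Subtype.ext_iff, eq_comm, i.2]

theorem sum_baseParam_sq (hd : 0 < d) : ∑ j, baseParam d κ j ^ 2 = κ ^ 2 := by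
  simp [baseParam_eq_single hd, ite_pow]

theorem sum_altParam_sq (hd : 0 < d) (i : {j : Fin d // (j : ℕ) ≠ 0}) :
    ∑ j, altParam d κ η i j ^ 2 = κ ^ 2 + η ^ 2 := by
  have h : ∀ j, altParam d κ η i j ^ 2 = baseParam d κ j ^ 2 + if j = i.1 then η ^ 2 else 0 := by
    intro j
    unfold altParam
    split_ifs with h
    · have : baseParam d κ j = 0 := by rw [h, baseParam, if_neg i.2]
      rw [this]; ring
    · ring
  simp only [h, Finset.sum_add_distrib, sum_baseParam_sq hd, Finset.sum_ite_eq', Finset.mem_univ,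
    if_true]

theorem mdp_isInstance (hd : 0 < d) (hu : 0 < u) (hv : 0 < v) (hu1 : u ≤ 1) (hΔ : 0 < Δ)
    (hΔ' : Δ ≤ ξ d) (hm : ∀ a, armMean d Δ (baseParam d κ) a ∈ Set.Ioo (0 : ℝ) 1) :
    IsInstance d κ u v Δ (mdp d u v Δ (baseParam d κ) hd hu hu1 hΔ hΔ' hm) := by
  have h : transVec d κ u v = transVecOf d u v (baseParam d κ) := by
    funext s
    cases s with
    | start => rfl
    | good =>
      refine congrArg (WithLp.toLp 2) (congrArg (fun f => Fin.snoc (α := fun _ => ℝ) f _) ?_)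
      funext j; unfold baseParam; split_ifs <;> simp
    | bad i =>
      refine congrArg (fun f => (1 / (d : ℝ)) • WithLp.toLp 2 f)
        (congrArg (fun f => Fin.snoc (α := fun _ => ℝ) f _) ?_)
      funext j; unfold baseParam; split_ifs <;> simp
  refine ⟨rfl, fun a s => ?_, fun a => rfl, fun s a => rfl⟩
  rw [h, inner_feat_transVecOf hu.ne' hv.ne']
  rfl

/-- The likelihood ratio of the transition probabilities for two bandit parameters. -/
def transRatio (d : ℕ) (Δ : ℝ) (θ θ' : Fin d → ℝ) (a : Arm d) : State d → ℝ
  | .start => 1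
  | .good => armMean d Δ θ' a / armMean d Δ θ a
  | .bad _ => (1 - armMean d Δ θ' a) / (1 - armMean d Δ θ a)

theorem transRatio_pos (hm : ∀ a, armMean d Δ θ a ∈ Set.Ioo (0 : ℝ) 1)
    (hm' : ∀ a, armMean d Δ θ' a ∈ Set.Ioo (0 : ℝ) 1) (a : Arm d) (s : State d) :
    0 < transRatio d Δ θ θ' a s := by
  have h1 := hm a
  have h2 := hm' a
  cases s with
  | start => exact one_pos
  | good => exact div_pos h2.1 h1.1
  | bad i => exact div_pos (by linarith [h2.2]) (by linarith [h1.2])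

theorem transProb_mul_transRatio (hm : ∀ a, armMean d Δ θ a ∈ Set.Ioo (0 : ℝ) 1)
    (a : Arm d) (s : State d) :
    transProb d Δ θ' a s = transProb d Δ θ a s * transRatio d Δ θ θ' a s := by
  have h1 := (hm a).1.ne'
  have h2 : 1 - armMean d Δ θ a ≠ 0 := by linarith [(hm a).2]
  cases s with
  | start => simp [transProb]
  | good => simp only [transProb, transRatio]; field_simp
  | bad i => simp only [transProb, transRatio]; field_simp

theorem neg_sq_sub_le_sum_transProb (hd : 0 < d)
    (hm : ∀ a, armMean d Δ θ a ∈ Set.Ioo (0 : ℝ) 1)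
    (hm' : ∀ a, armMean d Δ θ' a ∈ Set.Icc (1 / 4 : ℝ) (3 / 4)) (a : Arm d) :
    -(6 * (armMean d Δ θ a - armMean d Δ θ' a) ^ 2) ≤
      ∑ s, transProb d Δ θ a s * Real.log (transRatio d Δ θ θ' a s) := by
  have hd' : (d : ℝ) ≠ 0 := by exact_mod_cast hd.ne'
  refine (neg_sq_sub_le_bernoulli (hm a).1 (hm a).2 (hm' a).1 (hm' a).2).trans (le_of_eq ?_)
  rw [sum_state]
  simp only [transProb, transRatio, Finset.sum_const, Finset.card_univ, Fintype.card_fin,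
    nsmul_eq_mul]
  field_simp
  ring

theorem measurable_play_apply (L : Learner (State d) (Arm d)) (k : ℕ) (a : Arm d) :
    Measurable fun ω => (L.play k (L.obs k ω) 0 .start : Arm d → ℝ) a :=
  ((measurable_pi_apply a).comp measurable_subtype_coe).comp
    ((measurable_pi_apply State.start).comp ((measurable_pi_apply (0 : Fin 2)).comp
      ((L.measurable_play k).comp (L.measurable_obs k))))

theorem policy_nonneg (π : Policy (State d) (Arm d)) (a : Arm d) :
    0 ≤ (π 0 .start : Arm d → ℝ) a := (π 0 .start).2.1 a

theorem policy_le_one (π : Policy (State d) (Arm d)) (a : Arm d) :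
    (π 0 .start : Arm d → ℝ) a ≤ 1 := by
  have h : ∑ a, (π 0 .start : Arm d → ℝ) a = 1 := (π 0 .start).2.2
  rw [← h]
  exact Finset.single_le_sum (fun b _ => policy_nonneg π b) (Finset.mem_univ a)

theorem integrable_play_apply (L : Learner (State d) (Arm d)) (M : TwoStepMDP (State d) (Arm d))
    (k : ℕ) (a : Arm d) :
    Integrable (fun ω => (L.play k (L.obs k ω) 0 .start : Arm d → ℝ) a) (L.runLaw M) :=
  Integrable.of_bound (measurable_play_apply L k a).aestronglyMeasurable 1
    (Filter.Eventually.of_forall fun ω => by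
      rw [Real.norm_of_nonneg (policy_nonneg _ a)]; exact policy_le_one _ a)

/-- The expected number of times the action `a` is played at step 1 in the first `n` episodes. -/
def visits (L : Learner (State d) (Arm d)) (M : TwoStepMDP (State d) (Arm d)) (n : ℕ)
    (a : Arm d) : ℝ :=
  ∑ k ∈ Finset.range n, ∫ ω, (L.play k (L.obs k ω) 0 .start : Arm d → ℝ) a ∂(L.runLaw M)

theorem visits_nonneg (L : Learner (State d) (Arm d)) (M : TwoStepMDP (State d) (Arm d)) (n : ℕ)
    (a : Arm d) : 0 ≤ visits L M n a :=
  Finset.sum_nonneg fun _ _ => integral_nonneg fun _ => policy_nonneg _ a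

theorem sum_visits (L : Learner (State d) (Arm d)) (M : TwoStepMDP (State d) (Arm d)) (n : ℕ) :
    ∑ a, visits L M n a = n := by
  simp only [visits]
  rw [Finset.sum_comm]
  have : ∀ k, ∑ a, ∫ ω, (L.play k (L.obs k ω) 0 .start : Arm d → ℝ) a ∂(L.runLaw M) = 1 := by
    intro k
    rw [← integral_finsetSum _ fun a _ => integrable_play_apply L M k a]
    have h : ∀ ω, ∑ a, (L.play k (L.obs k ω) 0 .start : Arm d → ℝ) a = 1 :=
      fun ω => (L.play k (L.obs k ω) 0 .start).2.2
    simp [h]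
  simp [this]

/-- A linear combination of the probabilities of the actions, summed over the episodes. -/
theorem sum_integral_eq_sum_visits (L : Learner (State d) (Arm d))
    (M : TwoStepMDP (State d) (Arm d)) (n : ℕ) (g : Arm d → ℝ) :
    ∑ k ∈ Finset.range n, ∫ ω, ∑ a, (L.play k (L.obs k ω) 0 .start : Arm d → ℝ) a * g a
      ∂(L.runLaw M) = ∑ a, visits L M n a * g a := by
  simp only [visits, Finset.sum_mul]
  rw [Finset.sum_comm]
  refine Finset.sum_congr rfl fun k _ => ?_
  rw [integral_finsetSum _ fun a _ => (integrable_play_apply L M k a).mul_const _]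
  exact Finset.sum_congr rfl fun a _ => integral_mul_const _ _

section mdp

variable (hd : 0 < d) (hu : 0 < u) (hu1 : u ≤ 1) (hΔ : 0 < Δ) (hΔ' : Δ ≤ ξ d)
  (hm : ∀ a, armMean d Δ θ a ∈ Set.Ioo (0 : ℝ) 1)

theorem sum_visits_mul_gap_le (L : Learner (State d) (Arm d)) (n : ℕ) (b : Arm d)
    {C₁ C₂ α : ℝ} (hn : 1 ≤ n)
    (hreg : L.LowRegret (mdp d u v Δ θ hd hu hu1 hΔ hΔ' hm) C₁ C₂ α) :
    ∑ a, visits L (mdp d u v Δ θ hd hu hu1 hΔ hΔ' hm) n a *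
      (armMean d Δ θ b - armMean d Δ θ a) ≤ C₁ * (n : ℝ) ^ α + C₂ := by
  refine le_trans ?_ (hreg n hn)
  rw [← sum_integral_eq_sum_visits]
  refine Finset.sum_le_sum fun k _ => integral_mono ?_ ?_ fun ω => ?_
  · exact integrable_finsetSum _ fun a _ => (integrable_play_apply L _ k a).mul_const _
  · simp only [value_mdp]
    exact (integrable_const _).sub
      (integrable_finsetSum _ fun a _ => (integrable_play_apply L _ k a).mul_const _)
  · exact sum_gap_le hd hu hu1 hΔ hΔ' hm b _

/-- The visits needed to tell the parameter `θ` from the parameter `θ'`. -/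
theorem log_le_sum_visits (hm' : ∀ a, armMean d Δ θ' a ∈ Set.Icc (1 / 4 : ℝ) (3 / 4))
    (hm'' : ∀ a, armMean d Δ θ' a ∈ Set.Ioo (0 : ℝ) 1)
    (L : Learner (State d) (Arm d)) (n : ℕ) {Q : Set (Policy (State d) (Arm d))}
    (hQ : MeasurableSet Q) {ε δ : ℝ} (hδ : 0 < δ) (hδ' : δ < 5 / 12)
    {𝓜 : Set (TwoStepMDP (State d) (Arm d))} (hL : L.IsPAC 𝓜 ε δ)
    (h𝓜 : mdp d u v Δ θ hd hu hu1 hΔ hΔ' hm ∈ 𝓜)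
    (h𝓜' : mdp d u v Δ θ' hd hu hu1 hΔ hΔ' hm'' ∈ 𝓜)
    (hopt : ∀ π, (mdp d u v Δ θ hd hu hu1 hΔ hΔ' hm).optValue -
      (mdp d u v Δ θ hd hu hu1 hΔ hΔ' hm).value π ≤ ε → π ∈ Q)
    (hopt' : ∀ π, (mdp d u v Δ θ' hd hu hu1 hΔ hΔ' hm'').optValue -
      (mdp d u v Δ θ' hd hu hu1 hΔ hΔ' hm'').value π ≤ ε → π ∉ Q)
    (hK : L.expectedEpisodes (mdp d u v Δ θ hd hu hu1 hΔ hΔ' hm) ≤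
      ENNReal.ofReal (((n : ℝ) + 1) / 24)) :
    Real.log (1 / δ) / 200 ≤ ∑ a, visits L (mdp d u v Δ θ hd hu hu1 hΔ hΔ' hm) n a *
      (6 * (armMean d Δ θ a - armMean d Δ θ' a) ^ 2) := by
  have h := L.sum_integral_log_le_of_disjoint_outputs (M := mdp d u v Δ θ hd hu hu1 hΔ hΔ' hm)
    (M' := mdp d u v Δ θ' hd hu hu1 hΔ hΔ' hm'') (w := transRatio d Δ θ θ') rfl rfl rfl
    (transRatio_pos hm hm'') (transProb_mul_transRatio hm) n hQ hδ hδ'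
    ((hL _ h𝓜).trans (measure_mono fun ω ⟨k, hk, hk'⟩ => ⟨k, hk, hopt _ hk'⟩))
    ((hL _ h𝓜').trans (measure_mono fun ω ⟨k, hk, hk'⟩ => ⟨k, hk, hopt' _ hk'⟩)) hK
  have h2 := sum_integral_eq_sum_visits L (mdp d u v Δ θ hd hu hu1 hΔ hΔ' hm) n
    fun z => ∑ s, transProb d Δ θ z s * Real.log (transRatio d Δ θ θ' z s)
  have h3 := h2.symm.trans_le h
  have h4 : ∑ a, visits L (mdp d u v Δ θ hd hu hu1 hΔ hΔ' hm) n a *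
      -(6 * (armMean d Δ θ a - armMean d Δ θ' a) ^ 2) ≤ -(Real.log (1 / δ) / 200) :=
    (Finset.sum_le_sum fun a _ => mul_le_mul_of_nonneg_left
      (neg_sq_sub_le_sum_transProb hd hm hm' a) (visits_nonneg L _ n a)).trans h3
  simp only [mul_neg, Finset.sum_neg_distrib] at h4
  linarith

end mdp

end BanditMDP

namespace BanditMDP

variable {d : ℕ} {u v Δ κ η ε : ℝ}

theorem armMean_baseParam_mem (hd : 0 < d) (hκ : 0 < κ) (hΔ : 0 < Δ) (hΔ' : Δ ≤ ξ d)
    (hκξ : κ * ξ d ≤ 1 / 52) (a : Arm d) :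
    armMean d Δ (baseParam d κ) a ∈ Set.Icc (1 / 2 : ℝ) (1 / 2 + 1 / 52) := by
  have h1 : 0 < κ * ξ d := mul_pos hκ (ξ_pos hd)
  have h2 : κ * Δ ≤ κ * ξ d := mul_le_mul_of_nonneg_left hΔ' hκ.le
  have h3 : 0 < κ * Δ := mul_pos hκ hΔ
  cases a with
  | best => rw [armMean_baseParam_best hd]; constructor <;> linarith
  | null => rw [armMean_baseParam_null]; constructor <;> linarith
  | basis i => rw [armMean_baseParam_basis hd]; constructor <;> linarith
  | near i => rw [armMean_baseParam_near hd]; constructor <;> linarith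

theorem armMean_altParam_mem (hd : 0 < d) (hκ : 0 < κ) (hΔ : 0 < Δ) (hΔ' : Δ ≤ ξ d)
    (hκξ : κ * ξ d ≤ 1 / 52) (hη : 0 ≤ η) (hη' : η ≤ 1 / 52) (i : {j : Fin d // (j : ℕ) ≠ 0})
    (a : Arm d) :
    armMean d Δ (altParam d κ η i) a ∈ Set.Icc (1 / 4 : ℝ) (3 / 4) := by
  have hb := armMean_baseParam_mem hd hκ hΔ hΔ' hκξ a
  have hv : vec d Δ a i.1 ∈ Set.Icc (0 : ℝ) 1 := by
    have h1 := γ_pos hd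
    have h2 := γ_le hd
    cases a with
    | best => rw [vec_best_coe]; simp
    | null => simp [vec]
    | basis j => rw [vec_basis_coe]; split_ifs <;> simp
    | near j => rw [vec_near_coe]; split_ifs <;> constructor <;> linarith
  have h1 := mul_nonneg hv.1 hη
  have h2 := mul_le_mul hv.2 hη' hη zero_le_one
  rw [armMean_altParam]
  constructor <;> linarith [hb.1, hb.2]

/-- In the base environment an `ε`-optimal policy rarely plays the arm `near i`. -/
theorem near_le_of_sum_gap_le (hd : 0 < d) (hκ : 0 < κ) (hε : 0 < ε) (hκΔ : κ * Δ = 3 * ε)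
    (hξ : κ * Δ ≤ κ * ξ d) (i : {j : Fin d // (j : ℕ) ≠ 0}) (π : Policy (State d) (Arm d))
    (h : ∑ a, (π 0 .start : Arm d → ℝ) a *
      (armMean d Δ (baseParam d κ) .best - armMean d Δ (baseParam d κ) a) ≤ ε) :
    (π 0 .start : Arm d → ℝ) (.near i) ≤ 1 / 3 := by
  have h1 : 0 < κ * ξ d := mul_pos hκ (ξ_pos hd)
  have h2 : ∀ a ∈ Finset.univ, 0 ≤ (π 0 .start : Arm d → ℝ) a *
      (armMean d Δ (baseParam d κ) .best - armMean d Δ (baseParam d κ) a) := by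
    intro a _
    refine mul_nonneg (policy_nonneg π a) ?_
    rw [armMean_baseParam_best hd]
    cases a with
    | best => rw [armMean_baseParam_best hd]; linarith
    | null => rw [armMean_baseParam_null]; linarith
    | basis i => rw [armMean_baseParam_basis hd]; linarith
    | near i => rw [armMean_baseParam_near hd]; linarith
  have h3 := (Finset.single_le_sum h2 (Finset.mem_univ (.near i))).trans h
  rw [armMean_baseParam_best hd, armMean_baseParam_near hd] at h3
  nlinarith

/-- In the environment perturbed in direction `i` an `ε`-optimal policy often plays `near i`. -/
theorem le_near_of_sum_gap_le (hd : 0 < d) (hκ : 0 < κ) (hε : 0 < ε) (hκΔ : κ * Δ = 3 * ε)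
    (hηγ : γ d * η = 6 * ε) (hη : η ≤ κ * ξ d)
    (i : {j : Fin d // (j : ℕ) ≠ 0}) (π : Policy (State d) (Arm d))
    (h : ∑ a, (π 0 .start : Arm d → ℝ) a *
      (armMean d Δ (altParam d κ η i) (.near i) - armMean d Δ (altParam d κ η i) a) ≤ ε) :
    2 / 3 ≤ (π 0 .start : Arm d → ℝ) (.near i) := by
  have h1 : 0 < κ * ξ d := mul_pos hκ (ξ_pos hd)
  have h2 : ∀ a ∈ Finset.univ, (π 0 .start : Arm d → ℝ) a *
      (3 * ε - if a = .near i then 3 * ε else 0) ≤ (π 0 .start : Arm d → ℝ) a *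
      (armMean d Δ (altParam d κ η i) (.near i) - armMean d Δ (altParam d κ η i) a) := by
    intro a _
    refine mul_le_mul_of_nonneg_left ?_ (policy_nonneg π a)
    rw [armMean_altParam, armMean_altParam, armMean_baseParam_near hd, vec_near_coe, if_pos rfl]
    cases a with
    | best => rw [armMean_baseParam_best hd, vec_best_coe, if_neg (by simp)]; linarith
    | null => rw [armMean_baseParam_null, if_neg (by simp)]; simp only [vec]; linarith
    | basis j =>
      rw [armMean_baseParam_basis hd, vec_basis_coe, if_neg (by simp)]
      split_ifs
      · linarith
      · linarith
    | near j =>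
      rw [armMean_baseParam_near hd, vec_near_coe]
      by_cases hj : j = i
      · simp [hj]
      · rw [if_neg (by simpa using hj), if_neg hj]; linarith
  have h3 := (Finset.sum_le_sum h2).trans h
  have hs : ∑ a, (π 0 .start : Arm d → ℝ) a = 1 := (π 0 .start).2.2
  simp only [mul_sub, Finset.sum_sub_distrib, ← Finset.sum_mul, hs, mul_ite, mul_zero,
    Finset.sum_ite_eq', Finset.mem_univ, if_true] at h3
  nlinarith

section bound

variable (hd : 0 < d) (hu : 0 < u) (hu1 : u ≤ 1) (hΔ : 0 < Δ) (hΔ' : Δ ≤ ξ d)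
  (hm : ∀ a, armMean d Δ (baseParam d κ) a ∈ Set.Ioo (0 : ℝ) 1)

theorem sum_visits_basis_le (hκ : 0 < κ) (L : Learner (State d) (Arm d)) {n : ℕ}
    (hn : 1 ≤ n) {C₁ C₂ α : ℝ}
    (hreg : L.LowRegret (mdp d u v Δ (baseParam d κ) hd hu hu1 hΔ hΔ' hm) C₁ C₂ α) :
    κ * ξ d * ∑ i, visits L (mdp d u v Δ (baseParam d κ) hd hu hu1 hΔ hΔ' hm) n (.basis i) ≤
      C₁ * (n : ℝ) ^ α + C₂ := by
  have h1 : 0 < κ * ξ d := mul_pos hκ (ξ_pos hd)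
  have h2 : 0 < κ * Δ := mul_pos hκ hΔ
  refine le_trans ?_ (sum_visits_mul_gap_le hd hu hu1 hΔ hΔ' hm L n .best hn hreg)
  set V := visits L (mdp d u v Δ (baseParam d κ) hd hu hu1 hΔ hΔ' hm) n
  have hV : ∀ a, 0 ≤ V a := visits_nonneg L _ n
  rw [sum_arm]
  simp only [armMean_baseParam_best hd, armMean_baseParam_null, armMean_baseParam_basis hd,
    armMean_baseParam_near hd, ← Finset.sum_mul]
  have h3 : 0 ≤ V .null * (1 / 2 + κ * ξ d - 1 / 2) := mul_nonneg (hV _) (by linarith)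
  have h4 : 0 ≤ (∑ i, V (.near i)) * (1 / 2 + κ * ξ d - (1 / 2 + κ * ξ d - κ * Δ)) :=
    mul_nonneg (Finset.sum_nonneg fun i _ => hV _) (by linarith)
  linarith

theorem information_le_visits (hκ : 0 < κ) (hv : 0 < v) (huv : u ^ 2 + v ^ 2 ≤ 1)
    (hε : 0 < ε) (hκΔ : κ * Δ = 3 * ε) (hκξ : κ * ξ d ≤ 1 / 52) (hηγ : γ d * η = 6 * ε)
    (hη : η ≤ κ * ξ d) (hbase : 4 * κ ^ 2 / u ^ 2 + 1 / v ^ 2 ≤ (d : ℝ) + 1)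
    (halt : 4 * (κ ^ 2 + η ^ 2) / u ^ 2 + 1 / v ^ 2 ≤ (d : ℝ) + 1)
    (L : Learner (State d) (Arm d)) (n : ℕ) {δ : ℝ} (hδ : 0 < δ) (hδ' : δ < 5 / 12)
    (hL : L.IsPAC (environments d u v Δ) ε δ)
    (hK : L.expectedEpisodes (mdp d u v Δ (baseParam d κ) hd hu hu1 hΔ hΔ' hm) ≤
      ENNReal.ofReal (((n : ℝ) + 1) / 24)) :
    ((d : ℝ) - 1) * (Real.log (1 / δ) / 200) ≤ 6 * η ^ 2 *
      ∑ i, visits L (mdp d u v Δ (baseParam d κ) hd hu hu1 hΔ hΔ' hm) n (.basis i) +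
      216 * ε ^ 2 * n := by
  have hη0 : 0 < η := by
    have := γ_pos hd
    by_contra h
    nlinarith
  have hmem := mdp_mem_environments hd hu hu1 hΔ hΔ' hm hv huv
    (by rw [sum_baseParam_sq hd]; exact hbase)
  have hone : ∀ i, Real.log (1 / δ) / 200 ≤ 6 * η ^ 2 *
      visits L (mdp d u v Δ (baseParam d κ) hd hu hu1 hΔ hΔ' hm) n (.basis i) + 216 * ε ^ 2 *
      visits L (mdp d u v Δ (baseParam d κ) hd hu hu1 hΔ hΔ' hm) n (.near i) := by
    intro i
    have hm' := armMean_altParam_mem hd hκ hΔ hΔ' hκξ hη0.le (hη.trans hκξ) i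
    have hm'' : ∀ a, armMean d Δ (altParam d κ η i) a ∈ Set.Ioo (0 : ℝ) 1 := fun a =>
      ⟨by linarith [(hm' a).1], by linarith [(hm' a).2]⟩
    have hQ : MeasurableSet {π : Policy (State d) (Arm d) |
        (π 0 .start : Arm d → ℝ) (.near i) ≤ 1 / 3} := by
      refine measurableSet_le ?_ measurable_const
      exact ((measurable_pi_apply (Arm.near i)).comp measurable_subtype_coe).comp
        ((measurable_pi_apply State.start).comp (measurable_pi_apply (0 : Fin 2)))
    have h := log_le_sum_visits hd hu hu1 hΔ hΔ' hm hm' hm'' L n hQ hδ hδ' hL hmem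
      (mdp_mem_environments hd hu hu1 hΔ hΔ' hm'' hv huv
        (by rw [sum_altParam_sq hd]; exact halt))
      (fun π hπ => near_le_of_sum_gap_le hd hκ hε hκΔ (mul_le_mul_of_nonneg_left hΔ' hκ.le) i π
        ((sum_gap_le hd hu hu1 hΔ hΔ' hm .best π).trans hπ))
      (fun π hπ hπQ => by
        have h1 := le_near_of_sum_gap_le hd hκ hε hκΔ hηγ hη i π
          ((sum_gap_le hd hu hu1 hΔ hΔ' hm'' (.near i) π).trans hπ)
        have h2 : (π 0 .start : Arm d → ℝ) (.near i) ≤ 1 / 3 := hπQ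
        linarith) hK
    refine h.trans (le_of_eq ?_)
    have hdiff : ∀ a, (armMean d Δ (baseParam d κ) a - armMean d Δ (altParam d κ η i) a) ^ 2 =
        vec d Δ a i.1 ^ 2 * η ^ 2 := fun a => by rw [armMean_altParam]; ring
    simp only [hdiff]
    rw [sum_arm]
    have hnull : vec d Δ .null i.1 = 0 := rfl
    have h36 : γ d ^ 2 * η ^ 2 = 36 * ε ^ 2 := by rw [← mul_pow, hηγ]; ring
    simp only [vec_best_coe, vec_basis_coe, vec_near_coe, hnull, ite_pow, ite_mul, h36]
    simp
    ring
  have hcard : (Fintype.card {j : Fin d // (j : ℕ) ≠ 0} : ℝ) = d - 1 := by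
    have h0 : Fintype.card {j : Fin d // (j : ℕ) ≠ 0} = d - 1 := by
      have : ∀ j : Fin d, (j : ℕ) ≠ 0 ↔ j ≠ ⟨0, hd⟩ := fun j => by simp [Fin.ext_iff]
      rw [Fintype.card_congr (Equiv.subtypeEquivRight this)]
      simp
    rw [h0, Nat.cast_sub hd, Nat.cast_one]
  have hsum := Finset.sum_le_sum fun i (_ : i ∈ Finset.univ) => hone i
  rw [Finset.sum_const, Finset.card_univ, nsmul_eq_mul, hcard, Finset.sum_add_distrib,
    ← Finset.mul_sum, ← Finset.mul_sum] at hsum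
  refine hsum.trans (add_le_add_right (mul_le_mul_of_nonneg_left ?_ (by positivity)) _)
  rw [← sum_visits L (mdp d u v Δ (baseParam d κ) hd hu hu1 hΔ hΔ' hm) n, sum_arm]
  have hV := visits_nonneg L (mdp d u v Δ (baseParam d κ) hd hu hu1 hΔ hΔ' hm) n
  have := Finset.sum_nonneg fun i (_ : i ∈ Finset.univ) => hV (.basis i)
  linarith [hV .best, hV .null]

end bound

theorem mul_ξ_le (hd : 2 < d) (hκ : 0 < κ) (hu : 0 < u) (hu1 : u ≤ 1)
    (h : 4 * κ ^ 2 / u ^ 2 + 1 / v ^ 2 < (d : ℝ) + 1) : κ * ξ d ≤ 1 / 52 := by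
  have hd' : (2 : ℝ) < d := by exact_mod_cast hd
  have h1 : 4 * κ ^ 2 ≤ 4 * κ ^ 2 / u ^ 2 := by
    rw [le_div_iff₀ (by positivity)]
    have : u ^ 2 ≤ 1 := pow_le_one₀ hu.le hu1
    nlinarith [sq_nonneg κ]
  have h2 : 0 ≤ 1 / v ^ 2 := by positivity
  have h3 : κ ≤ d := by nlinarith
  unfold ξ
  rw [mul_one_div, div_le_div_iff₀ (by positivity) (by norm_num)]
  linarith

theorem not_information_le {D ε X B n : ℝ} (hD : 2 < D) (hε : 0 < ε) (hX : 0 < X)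
    (hB : 800 * (584064 * B) < X) (hn : n ≤ 1 / 172800 * D * X) :
    ¬ (D - 1) * (X * ε ^ 2 / 200) ≤ 6 * (97344 * D * ε ^ 2) * B + 216 * ε ^ 2 * n := by
  intro h
  have h1 : (D - 1) * (X / 200) ≤ 584064 * D * B + 216 * n := by
    refine le_of_mul_le_mul_right ?_ (by positivity : 0 < ε ^ 2)
    calc _ = (D - 1) * (X * ε ^ 2 / 200) := by ring
      _ ≤ _ := h
      _ = _ := by ring
  have h2 : D / 2 * (X / 200) ≤ (D - 1) * (X / 200) :=
    mul_le_mul_of_nonneg_right (by linarith) (by positivity)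
  have h3 : D * (800 * (584064 * B)) < D * X := mul_lt_mul_of_pos_left hB (by linarith)
  linarith

end BanditMDP

end

theorem mainTheorem3 :
    ∃ c > (0 : ℝ),
      ∀ (d : ℕ), 2 < d →
      ∀ (κ u v : ℝ), 0 < κ → 0 < u → 0 < v → u ^ 2 + v ^ 2 ≤ 1 →
        4 * κ ^ 2 / u ^ 2 + 1 / v ^ 2 < (d : ℝ) + 1 →
      ∀ (C₁ C₂ α : ℝ), 0 < α → α < 1 →
      ∃ ε₀ > (0 : ℝ), ∀ (ε : ℝ), 0 < ε → ε < ε₀ →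
      ∃ M : TwoStepMDP (BanditMDP.State d) (BanditMDP.Arm d),
        BanditMDP.IsInstance d κ u v (3 * ε / κ) M ∧
        M ∈ BanditMDP.environments d u v (3 * ε / κ) ∧
        ∀ (δ : ℝ), 0 < δ → δ < 5 / 12 →
        ∀ L : Learner (BanditMDP.State d) (BanditMDP.Arm d),
          L.LowRegret M C₁ C₂ α →
          L.IsPAC (BanditMDP.environments d u v (3 * ε / κ)) ε δ →
          ENNReal.ofReal (c * (d * Real.log (1 / δ) / ε ^ 2)) ≤ L.expectedEpisodes M := by
  refine ⟨1 / 172800 / 24, by norm_num, ?_⟩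
  intro d hd2 κ u v hκ hu hv huv hslack C₁ C₂ α hα hα1
  have hd : 0 < d := by omega
  have hd' : (2 : ℝ) < d := by exact_mod_cast hd2
  have hu1 : u ≤ 1 := by nlinarith
  have hξ := BanditMDP.ξ_pos hd
  have hγ := BanditMDP.γ_pos hd
  have hγ1 := BanditMDP.γ_le hd
  have hκξ := BanditMDP.mul_ξ_le hd2 hκ hu hu1 hslack
  have hκξ0 : 0 < κ * BanditMDP.ξ d := mul_pos hκ hξ
  have hγ2 : BanditMDP.γ d ^ 2 = 1 / (2704 * d) := by
    unfold BanditMDP.γ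
    rw [div_pow, mul_pow, Real.sq_sqrt (by linarith)]
    norm_num
  set τ := (d : ℝ) + 1 - (4 * κ ^ 2 / u ^ 2 + 1 / v ^ 2) with hτ
  have hτ0 : 0 < τ := by rw [hτ]; linarith
  obtain ⟨X₀, hX₀1, hX₀⟩ := exists_forall_rpow_add_lt |C₁| |C₂|
    (800 * (584064 / (κ * BanditMDP.ξ d))) α (a := 1 / 172800 * d) hα1 (by positivity)
  refine ⟨min (BanditMDP.γ d / 6 * min (κ * BanditMDP.ξ d) (τ * u ^ 2 / 4)) (1 / (2 * X₀)),
    by positivity, ?_⟩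
  intro ε hε hε₀
  obtain ⟨hε1, hε2⟩ := lt_min_iff.1 hε₀
  set η := 6 * ε / BanditMDP.γ d with hηdef
  have hηγ : BanditMDP.γ d * η = 6 * ε := by rw [hηdef]; field_simp
  have hη0 : 0 < η := by positivity
  have hηmin : η < min (κ * BanditMDP.ξ d) (τ * u ^ 2 / 4) := by
    rw [hηdef, div_lt_iff₀ hγ]; linarith
  obtain ⟨hη1, hη2⟩ := lt_min_iff.1 hηmin
  set Δ := 3 * ε / κ with hΔdef
  have hκΔ : κ * Δ = 3 * ε := by rw [hΔdef]; field_simp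
  have hΔ : 0 < Δ := by positivity
  have hΔ' : Δ ≤ BanditMDP.ξ d := by
    have h1 : 6 * ε ≤ η := by rw [← hηγ]; nlinarith
    have h2 : κ * Δ ≤ κ * BanditMDP.ξ d := by linarith
    exact le_of_mul_le_mul_left h2 hκ
  have hmI := BanditMDP.armMean_baseParam_mem hd hκ hΔ hΔ' hκξ
  have hm : ∀ a, BanditMDP.armMean d Δ (BanditMDP.baseParam d κ) a ∈ Set.Ioo (0 : ℝ) 1 :=
    fun a => ⟨by linarith [(hmI a).1], by linarith [(hmI a).2]⟩
  have halt : 4 * (κ ^ 2 + η ^ 2) / u ^ 2 + 1 / v ^ 2 ≤ (d : ℝ) + 1 := by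
    have h1 : 4 * η ^ 2 / u ^ 2 ≤ τ := by
      rw [div_le_iff₀ (by positivity)]
      have : η ^ 2 ≤ η := by nlinarith
      linarith
    have h2 : 4 * (κ ^ 2 + η ^ 2) / u ^ 2 = 4 * κ ^ 2 / u ^ 2 + 4 * η ^ 2 / u ^ 2 := by ring
    rw [h2]
    linarith
  refine ⟨BanditMDP.mdp d u v Δ (BanditMDP.baseParam d κ) hd hu hu1 hΔ hΔ' hm,
    BanditMDP.mdp_isInstance hd hu hv hu1 hΔ hΔ' hm,
    BanditMDP.mdp_mem_environments hd hu hu1 hΔ hΔ' hm hv huv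
      (by rw [BanditMDP.sum_baseParam_sq hd]; exact hslack.le), ?_⟩
  intro δ hδ hδ' L hreg hpac
  by_contra hcon
  have hlt := not_le.1 hcon
  set ℓ := Real.log (1 / δ) with hℓ
  have hℓ0 : 1 / 2 ≤ ℓ := by
    have h1 := Real.log_le_sub_one_of_pos hδ
    rw [hℓ, show Real.log (1 / δ) = -Real.log δ by rw [one_div, Real.log_inv]]
    linarith
  set X := ℓ / ε ^ 2 with hXdef
  have hℓX : ℓ = X * ε ^ 2 := by rw [hXdef]; field_simp
  have hX : X₀ ≤ X := by
    rw [hXdef, le_div_iff₀ (by positivity)]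
    have hX₀0 : 0 < X₀ := by linarith
    have h1 : 2 * X₀ * ε ≤ 1 := by
      rw [lt_div_iff₀ (by positivity)] at hε2
      linarith
    have h2 : ε ≤ 2 * X₀ * ε := le_mul_of_one_le_left hε.le (by linarith)
    have h3 : 2 * X₀ * ε * ε ≤ 1 * 1 := mul_le_mul h1 (h2.trans h1) hε.le zero_le_one
    have h4 : X₀ * ε ^ 2 = 2 * X₀ * ε * ε / 2 := by ring
    rw [h4]
    linarith
  obtain ⟨hX1, hX2⟩ := hX₀ X hX
  set a : ℝ := 1 / 172800 * d with hadef
  set n := ⌊a * X⌋₊ with hndef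
  have hn : 1 ≤ n := Nat.le_floor (by simpa using hX1)
  have hnle : (n : ℝ) ≤ a * X := Nat.floor_le (by linarith)
  have hnlt : a * X < n + 1 := Nat.lt_floor_add_one _
  have hK : L.expectedEpisodes
      (BanditMDP.mdp d u v Δ (BanditMDP.baseParam d κ) hd hu hu1 hΔ hΔ' hm) ≤
      ENNReal.ofReal (((n : ℝ) + 1) / 24) := by
    refine hlt.le.trans (ENNReal.ofReal_le_ofReal ?_)
    have : 1 / 172800 / 24 * (d * ℓ / ε ^ 2) = a * X / 24 := by rw [hadef, hXdef]; ring
    rw [this]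
    linarith
  have hinfo := BanditMDP.information_le_visits hd hu hu1 hΔ hΔ' hm hκ hv huv hε hκΔ hκξ hηγ
    hη1.le hslack.le halt L n hδ hδ' hpac hK
  have hvis := BanditMDP.sum_visits_basis_le hd hu hu1 hΔ hΔ' hm hκ L hn hreg
  set B := ∑ i, BanditMDP.visits L
    (BanditMDP.mdp d u v Δ (BanditMDP.baseParam d κ) hd hu hu1 hΔ hΔ' hm) n (.basis i)
  have hη2' : η ^ 2 = 97344 * d * ε ^ 2 := by
    rw [hηdef, div_pow, hγ2]
    field_simp
    norm_num
  have hR : B ≤ (|C₁| * (a * X) ^ α + |C₂|) / (κ * BanditMDP.ξ d) := by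
    rw [le_div_iff₀ hκξ0, mul_comm]
    refine hvis.trans (add_le_add ?_ (le_abs_self _))
    exact (mul_le_mul_of_nonneg_right (le_abs_self _) (by positivity)).trans
      (mul_le_mul_of_nonneg_left (Real.rpow_le_rpow (by positivity) hnle hα.le) (abs_nonneg _))
  have hfin : 800 * (584064 * B) < X := by
    refine lt_of_le_of_lt ?_ hX2
    refine le_trans (mul_le_mul_of_nonneg_left (mul_le_mul_of_nonneg_left hR
      (by norm_num)) (by norm_num)) (le_of_eq ?_)
    ring
  rw [← hℓ, hℓX, hη2'] at hinfo
  exact BanditMDP.not_information_le hd' hε (by linarith) hfin hnle hinfo
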